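/- Let $k\ge 1$ and let $n_1,\dots,n_k$ be positive integers with $N=\sum_{i=1}^k n_i\ge 2$, let $l>N$ be an integer, and let $Q_1,\dots,Q_k$ be pairwise distinct nonzero complex numbers with fixed arguments, so that the functions $Q_i^x$ of $x\in\mathbb C$ are defined. Let $\mathbb C_l[x]$ be the space of complex polynomials of degree less than $l$, let $Gr(m,l)$ be the Grassmannian of $m$-dimensional subspaces of $\mathbb C_l[x]$, and put $n=lN-\sum_{i=1}^k n_i^2+1$. For functions $f_1,\dots,f_N$ of a complex variable let $$\mathrm{Wr}^d(f_1,\dots,f_N)(x)=\det\bigl(f_r(x+c-1)\bigr)_{r,c=1}^N$$ be their discrete Wronskian. For $V_i\in Gr(n_i,l)$ with bases $p_{i,1},\dots,p_{i,n_i}$, $i=1,\dots,k$, the function $$w(x)=\mathrm{Wr}^d\bigl(p_{1,1}(x)Q_1^x,\dots,p_{1,n_1}(x)Q_1^x,\dots,p_{k,1}(x)Q_k^x,\dots,p_{k,n_k}(x)Q_k^x\bigr)\prod_{i=1}^kQ_i^{-n_ix}$$ is a nonzero polynomial of degree less than $n$, and the line $\mathbb C w$ does not depend on the choice of the bases. The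 resulting discrete Wronski map $$Gr(n_1,l)\times\dots\times Gr(n_k,l)\to Gr(1,n)=\mathbb P(\mathbb C_n[x]),\qquad (V_1,\dots,V_k)\mapsto\mathbb C w,$$ is a finite morphism of complex projective varieties, where the product of Grassmannians carries the structure of a projective variety given by the Plücker embeddings followed by the Segre embedding. -/

import Mathlib

open AlgebraicGeometry CategoryTheory MvPolynomial

attribute [instance] MvPolynomial.gradedAlgebra

noncomputable section

namespace DiscreteWronski

/-! ### Grassmannians of spaces of polynomials -/

/-- `Gr(m, l)`: the set of `m`-dimensional subspaces of the space `ℂ_l[x]` of complex polynomials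
of degree less than `l`. -/
def Gr (m l : ℕ) : Type :=
  {V : Submodule ℂ (Polynomial ℂ) // V ≤ Polynomial.degreeLT ℂ l ∧ Module.finrank ℂ V = m}

/-! ### The discrete Wronskian and the discrete Wronski map -/

/-- The discrete Wronskian `det (f_r(x + c))`, `r, c = 0, …, N - 1`, of `N` functions. -/
def discreteWronskian {N : ℕ} (f : Fin N → ℂ → ℂ) (x : ℂ) : ℂ :=
  (Matrix.of fun r c : Fin N => f r (x + (c : ℕ))).det

/-- The quasi-exponential function `p(x) Q^x`, where `Q = exp L` and the choice of the logarithm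
`L` fixes the argument of `Q`, so that `Q^x = exp (L x)`. -/
def quasiExp (p : Polynomial ℂ) (L : ℂ) (x : ℂ) : ℂ :=
  p.eval x * Complex.exp (L * x)

/-- The list `p_{1,1} Q_1^x, …, p_{1,d_1} Q_1^x, …, p_{k,1} Q_k^x, …, p_{k,d_k} Q_k^x`
of quasi-exponentials, in this order. -/
def quasiExpFamily {k : ℕ} (d : Fin k → ℕ) (L : Fin k → ℂ)
    (p : (i : Fin k) → Fin (d i) → Polynomial ℂ) (r : Fin (∑ i, d i)) : ℂ → ℂ :=
  quasiExp (p (finSigmaFinEquiv.symm r).1 (finSigmaFinEquiv.symm r).2)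
    (L (finSigmaFinEquiv.symm r).1)

/-- The number `n = l N - ∑ d_i² + 1`, `N = ∑ d_i`. The subtraction does not truncate as soon as
all `d_i ≤ l`. -/
def wronskiDim {k : ℕ} (d : Fin k → ℕ) (l : ℕ) : ℕ :=
  l * (∑ i, d i) - ∑ i, d i ^ 2 + 1

/-- `W` is the discrete Wronski map with bases `Q_i = exp (L i)`: for every choice of bases
`p_{i,1}, …, p_{i,d_i}` of the spaces `V_i`, the function
`Wr^d(p_{1,1} Q_1^x, …, p_{k,d_k} Q_k^x) ∏ Q_i^{- d_i x}` is a polynomial, and `W` sends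
`(V_1, …, V_k)` to the line spanned by it. -/
def IsDiscreteWronskiMap {k : ℕ} (d : Fin k → ℕ) (l : ℕ) (L : Fin k → ℂ)
    (W : ((i : Fin k) → Gr (d i) l) → Gr 1 (wronskiDim d l)) : Prop :=
  ∀ (V : (i : Fin k) → Gr (d i) l) (b : (i : Fin k) → Module.Basis (Fin (d i)) ℂ (V i).1),
    ∃ w : Polynomial ℂ,
      (∀ x : ℂ, w.eval x =
        discreteWronskian (quasiExpFamily d L fun i j => (b i j : Polynomial ℂ)) x *
          ∏ i, Complex.exp (-((d i : ℂ) * L i * x))) ∧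
      (W V).1 = Submodule.span ℂ {w}

/-! ### Projective varieties as schemes -/

section Quotient

variable {A : Type} [CommRing A] [Algebra ℂ A] (𝒜 : ℕ → Submodule ℂ A)

/-- The graded pieces of the quotient of a graded algebra by an ideal. -/
def quotientGrading (I : Ideal A) (n : ℕ) : Submodule ℂ (A ⧸ I) :=
  (𝒜 n).map (Ideal.Quotient.mkₐ ℂ I).toLinearMap

variable [GradedAlgebra 𝒜]

instance quotientGrading_gradedMonoid (I : Ideal A) :
    SetLike.GradedMonoid (quotientGrading 𝒜 I) where
  one_mem := ⟨1, SetLike.GradedOne.one_mem, map_one (Ideal.Quotient.mkₐ ℂ I)⟩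
  mul_mem := by
    rintro i j _ _ ⟨a, ha, rfl⟩ ⟨b, hb, rfl⟩
    exact ⟨a * b, SetLike.GradedMul.mul_mem ha hb, map_mul (Ideal.Quotient.mkₐ ℂ I) a b⟩

/-- The map from `𝒜 n` to the `n`-th graded piece of the quotient. -/
def toQuotientGrading (I : Ideal A) (n : ℕ) : 𝒜 n →ₗ[ℂ] quotientGrading 𝒜 I n :=
  ((Ideal.Quotient.mkₐ ℂ I).toLinearMap).restrict fun _ ha => Submodule.mem_map_of_mem ha

/-- The images in the quotient of the homogeneous components of the elements of `A`. -/
def preQuotientDecompose (I : Ideal A) :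
    A →ₗ[ℂ] DirectSum ℕ fun n => quotientGrading 𝒜 I n :=
  (DirectSum.lmap (toQuotientGrading 𝒜 I)).comp (DirectSum.decomposeLinearEquiv 𝒜).toLinearMap

theorem preQuotientDecompose_eq_zero (I : HomogeneousIdeal 𝒜) {a : A} (ha : a ∈ I.toIdeal) :
    preQuotientDecompose 𝒜 I.toIdeal a = 0 := by
  apply DirectSum.ext
  intro n
  apply Subtype.ext
  have h : preQuotientDecompose 𝒜 I.toIdeal a n =
      toQuotientGrading 𝒜 I.toIdeal n (DirectSum.decompose 𝒜 a n) :=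
    DirectSum.lmap_apply _ _ _
  rw [h]
  exact Ideal.Quotient.eq_zero_iff_mem.2 (I.isHomogeneous n ha)

/-- The decomposition into homogeneous components of the elements of the quotient. -/
def quotientDecompose (I : HomogeneousIdeal 𝒜) :
    (A ⧸ I.toIdeal) →ₗ[ℂ] DirectSum ℕ fun n => quotientGrading 𝒜 I.toIdeal n :=
  { toFun := QuotientAddGroup.lift (Submodule.toAddSubgroup I.toIdeal)
      (preQuotientDecompose 𝒜 I.toIdeal).toAddMonoidHom
      fun _ ha => preQuotientDecompose_eq_zero 𝒜 I ha
    map_add' := fun x y => map_add (QuotientAddGroup.lift (Submodule.toAddSubgroup I.toIdeal)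
      (preQuotientDecompose 𝒜 I.toIdeal).toAddMonoidHom
      fun _ ha => preQuotientDecompose_eq_zero 𝒜 I ha) x y
    map_smul' := by
      intro c x
      obtain ⟨a, rfl⟩ := Ideal.Quotient.mk_surjective x
      exact (preQuotientDecompose 𝒜 I.toIdeal).map_smul c a }

theorem quotientDecompose_mk_coe (I : HomogeneousIdeal 𝒜) {n : ℕ} (a : 𝒜 n) :
    quotientDecompose 𝒜 I (Ideal.Quotient.mk I.toIdeal (a : A)) =
      DirectSum.lof ℂ ℕ (fun n => quotientGrading 𝒜 I.toIdeal n) n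
        (toQuotientGrading 𝒜 I.toIdeal n a) := by
  have h : quotientDecompose 𝒜 I (Ideal.Quotient.mk I.toIdeal (a : A)) =
      DirectSum.lmap (toQuotientGrading 𝒜 I.toIdeal) (DirectSum.decompose 𝒜 (a : A)) := rfl
  rw [h, DirectSum.decompose_coe]
  exact DirectSum.lmap_lof _ _ _

instance quotientGrading_gradedAlgebra (I : HomogeneousIdeal 𝒜) :
    GradedAlgebra (quotientGrading 𝒜 I.toIdeal) :=
  { quotientGrading_gradedMonoid 𝒜 I.toIdeal,
    DirectSum.Decomposition.ofLinearMap (quotientGrading 𝒜 I.toIdeal) (quotientDecompose 𝒜 I)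
      (by
        refine LinearMap.ext fun x => ?_
        obtain ⟨a, rfl⟩ := Ideal.Quotient.mk_surjective x
        induction a using DirectSum.Decomposition.inductionOn 𝒜 with
        | zero => simp only [map_zero]
        | @homogeneous n a =>
          have h := quotientDecompose_mk_coe 𝒜 I a
          simp only [LinearMap.comp_apply, LinearMap.id_apply] at h ⊢
          rw [h, DirectSum.coeLinearMap_lof]
          rfl
        | add a b ha hb => simp only [map_add, ha, hb])
      (by
        refine DirectSum.linearMap_ext _ fun n => LinearMap.ext fun x => ?_
        obtain ⟨_, a, ha, rfl⟩ := x
        simp only [LinearMap.comp_apply, LinearMap.id_apply, DirectSum.coeLinearMap_lof]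
        exact quotientDecompose_mk_coe 𝒜 I ⟨a, ha⟩) with }

end Quotient

/-- The structure morphism `Proj 𝒜 ⟶ Spec ℂ` of the projective spectrum of a graded
`ℂ`-algebra. -/
def structureMorphism {A : Type} [CommRing A] [Algebra ℂ A] (𝒜 : ℕ → Submodule ℂ A)
    [GradedAlgebra 𝒜] : Proj 𝒜 ⟶ Spec (CommRingCat.of ℂ) :=
  Proj.toSpecZero 𝒜 ≫ Spec.map (CommRingCat.ofHom (algebraMap ℂ (𝒜 0)))

/-- The point of `Proj 𝒜` given by a point `χ : A → ℂ` of the affine cone, other than the vertex: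
the homogeneous prime ideal generated by the homogeneous elements that vanish at `χ`. -/
def conePoint {A : Type} [CommRing A] [Algebra ℂ A] (𝒜 : ℕ → Submodule ℂ A) [GradedAlgebra 𝒜]
    (χ : A →ₐ[ℂ] ℂ) (a : A) (ha : a ∈ 𝒜 1) (hχ : χ a ≠ 0) : Proj 𝒜 :=
  (⟨(RingHom.ker χ).homogeneousCore 𝒜, (RingHom.ker_isPrime χ).homogeneousCore, fun h =>
    hχ (Ideal.toIdeal_homogeneousCore_le 𝒜 (RingHom.ker χ)
      (h (HomogeneousIdeal.mem_irrelevant_of_mem 𝒜 one_pos ha)))⟩ : ProjectiveSpectrum 𝒜)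

section Variety

variable {σ : Type}

/-- The homogeneous ideal of a set of vectors: it is generated by the homogeneous polynomials
that vanish on the set. -/
def homogeneousVanishingIdeal (C : Set (σ → ℂ)) :
    HomogeneousIdeal (homogeneousSubmodule σ ℂ) :=
  ⟨Ideal.span {P | SetLike.IsHomogeneousElem (homogeneousSubmodule σ ℂ) P ∧
      ∀ v ∈ C, eval v P = 0},
    Ideal.homogeneous_span _ _ fun _ hP => hP.1⟩

/-- The grading of the homogeneous coordinate ring `ℂ[X_s : s ∈ σ] / I(C)`. -/
abbrev coordGrading (C : Set (σ → ℂ)) :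
    ℕ → Submodule ℂ (MvPolynomial σ ℂ ⧸ (homogeneousVanishingIdeal C).toIdeal) :=
  quotientGrading (homogeneousSubmodule σ ℂ) (homogeneousVanishingIdeal C).toIdeal

/-- The projective variety (as a reduced scheme over `ℂ`) in the projective space with homogeneous
coordinates `X_s`, `s ∈ σ`, whose points are represented by the vectors in `C`: the projective
spectrum of its homogeneous coordinate ring. -/
abbrev projectiveVariety (C : Set (σ → ℂ)) : Scheme.{0} :=
  Proj (coordGrading C)

/-- Evaluation of elements of the homogeneous coordinate ring at a vector in `C`. -/
def coordEval (C : Set (σ → ℂ)) (v : σ → ℂ) (hv : v ∈ C) :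
    (MvPolynomial σ ℂ ⧸ (homogeneousVanishingIdeal C).toIdeal) →ₐ[ℂ] ℂ :=
  Ideal.Quotient.liftₐ _ (aeval v) (by
    intro P hP
    have h : (homogeneousVanishingIdeal C).toIdeal ≤ RingHom.ker (aeval v : MvPolynomial σ ℂ →ₐ[ℂ] ℂ) :=
      Ideal.span_le.2 fun P hP => by
        simpa [RingHom.mem_ker, aeval_eq_eval] using hP.2 v hv
    exact h hP)

/-- The point of the projective variety with homogeneous coordinates `v`. -/
def varietyPoint (C : Set (σ → ℂ)) (v : σ → ℂ) (hv : v ∈ C) (h0 : ∃ s, v s ≠ 0) :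
    projectiveVariety C :=
  conePoint (coordGrading C) (coordEval C v hv) (Ideal.Quotient.mk _ (X h0.choose))
    (Submodule.mem_map_of_mem (f := (Ideal.Quotient.mkₐ ℂ _).toLinearMap)
      (isHomogeneous_X ℂ h0.choose))
    (by
      have h : coordEval C v hv (Ideal.Quotient.mk _ (X h0.choose)) = v h0.choose :=
        aeval_X v h0.choose
      rw [h]
      exact h0.choose_spec)

end Variety

/-! ### The product of Grassmannians as a projective variety -/

/-- The vector of coordinates of the image of a tuple of polynomial spaces with the given bases
`p i` under the product of the Plücker embeddings followed by the Segre embedding: its coordinates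
are the products over `i` of maximal minors of the matrices of coefficients of the `p i`. -/
def segrePlucker {k : ℕ} (d : Fin k → ℕ) (l : ℕ) (p : (i : Fin k) → Fin (d i) → Polynomial ℂ)
    (J : (i : Fin k) → Fin (d i) ↪o Fin l) : ℂ :=
  ∏ i, (Matrix.of fun r c : Fin (d i) => (p i r).coeff (J i c : ℕ)).det

/-- The set of all vectors of Segre–Plücker coordinates of points of
`Gr(d_1, l) × ⋯ × Gr(d_k, l)`. -/
def grCone {k : ℕ} (d : Fin k → ℕ) (l : ℕ) : Set (((i : Fin k) → Fin (d i) ↪o Fin l) → ℂ) :=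
  {v | ∃ (V : (i : Fin k) → Gr (d i) l) (b : (i : Fin k) → Module.Basis (Fin (d i)) ℂ (V i).1),
    v = segrePlucker d l fun i j => (b i j : Polynomial ℂ)}

theorem exists_minor_ne_zero {m l : ℕ} (p : Fin m → Polynomial ℂ) (hp : LinearIndependent ℂ p)
    (hl : ∀ r, p r ∈ Polynomial.degreeLT ℂ l) :
    ∃ J : Fin m ↪o Fin l, (Matrix.of fun r c : Fin m => (p r).coeff (J c : ℕ)).det ≠ 0 := by
  classical
  let M : Matrix (Fin m) (Fin l) ℂ := Matrix.of fun r c => (p r).coeff (c : ℕ)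
  have hM : LinearIndependent ℂ M.row := by
    have h1 : LinearIndependent ℂ fun r => (⟨p r, hl r⟩ : Polynomial.degreeLT ℂ l) :=
      LinearIndependent.of_comp (Polynomial.degreeLT ℂ l).subtype hp
    exact h1.map' (Polynomial.degreeLTEquiv ℂ l).toLinearMap (LinearEquiv.ker _)
  have hrank : Module.finrank ℂ (Submodule.span ℂ (Set.range M.col)) = m := by
    rw [← Matrix.rank_eq_finrank_span_cols, hM.rank_matrix, Fintype.card_fin]
  obtain ⟨s, hs⟩ : ∃ s : Finset (Fin l), s.card = m ∧
      LinearIndependent ℂ fun c : s => M.col c := by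
    obtain ⟨κ, a, ha, hspan, hli⟩ := exists_linearIndependent' ℂ M.col
    have : Finite κ := Finite.of_injective a ha
    have : Fintype κ := Fintype.ofFinite κ
    refine ⟨Finset.univ.map ⟨a, ha⟩, ?_, ?_⟩
    · rw [Finset.card_map, Finset.card_univ, ← hrank, ← hspan, finrank_span_eq_card hli]
    · have h2 : LinearIndependent ℂ fun c : Set.range a => M.col c :=
        (linearIndependent_equiv' (Equiv.ofInjective a ha) rfl).1 hli
      have h3 : ∀ c : (Finset.univ.map ⟨a, ha⟩ : Finset (Fin l)), (c : Fin l) ∈ Set.range a :=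
        fun c => by
          obtain ⟨j, -, hj⟩ := Finset.mem_map.1 c.2
          exact ⟨j, hj⟩
      exact h2.comp (fun c : (Finset.univ.map ⟨a, ha⟩ : Finset (Fin l)) => ⟨(c : Fin l), h3 c⟩) fun c c' h => Subtype.ext (Subtype.mk.inj h)
  refine ⟨s.orderEmbOfFin hs.1, ?_⟩
  have h4 : LinearIndependent ℂ fun c : Fin m => M.col (s.orderEmbOfFin hs.1 c) :=
    hs.2.comp (fun c => ⟨s.orderEmbOfFin hs.1 c, s.orderEmbOfFin_mem hs.1 c⟩)
      fun c c' h => (s.orderEmbOfFin hs.1).injective (Subtype.mk.inj h)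
  have h5 : IsUnit (Matrix.of fun r c : Fin m => (p r).coeff (s.orderEmbOfFin hs.1 c : ℕ)) :=
    Matrix.linearIndependent_cols_iff_isUnit.1 h4
  exact ((Matrix.isUnit_iff_isUnit_det _).1 h5).ne_zero

theorem exists_segrePlucker_ne_zero {k : ℕ} (d : Fin k → ℕ) (l : ℕ)
    (V : (i : Fin k) → Gr (d i) l) (b : (i : Fin k) → Module.Basis (Fin (d i)) ℂ (V i).1) :
    ∃ J, segrePlucker d l (fun i j => (b i j : Polynomial ℂ)) J ≠ 0 := by
  have h : ∀ i, ∃ J : Fin (d i) ↪o Fin l,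
      (Matrix.of fun r c : Fin (d i) => (b i r : Polynomial ℂ).coeff (J c : ℕ)).det ≠ 0 :=
    fun i => exists_minor_ne_zero (fun j => (b i j : Polynomial ℂ))
      ((b i).linearIndependent.map' (V i).1.subtype (Submodule.ker_subtype _))
      fun r => (V i).2.1 (b i r).2
  choose J hJ using h
  exact ⟨J, Finset.prod_ne_zero_iff.2 fun i _ => hJ i⟩

/-- The projective variety `Gr(d_1, l) × ⋯ × Gr(d_k, l)`, in the Segre–Plücker embedding. -/
abbrev productGr {k : ℕ} (d : Fin k → ℕ) (l : ℕ) : Scheme.{0} :=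
  projectiveVariety (grCone d l)

/-- The point of the variety `productGr d l` that corresponds to `(V_1, …, V_k)`, computed with
bases `b i` of the spaces `V_i`. (A change of bases multiplies the coordinates by a nonzero
constant, so that the point does not depend on the bases.) -/
def grPoint {k : ℕ} (d : Fin k → ℕ) (l : ℕ) (V : (i : Fin k) → Gr (d i) l)
    (b : (i : Fin k) → Module.Basis (Fin (d i)) ℂ (V i).1) : productGr d l :=
  varietyPoint (grCone d l) (segrePlucker d l fun i j => (b i j : Polynomial ℂ)) ⟨V, b, rfl⟩
    (exists_segrePlucker_ne_zero d l V b)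

/-! ### The projective space of lines in the space of polynomials -/

/-- The projective space of lines in the space of polynomials of degree less than `n`, with the
coefficients of polynomials as homogeneous coordinates. -/
abbrev projectiveSpace (n : ℕ) : Scheme.{0} :=
  Proj (homogeneousSubmodule (Fin n) ℂ)

theorem exists_coeff_ne_zero {n : ℕ} (w : Polynomial ℂ) (hw : w ∈ Polynomial.degreeLT ℂ n)
    (h0 : w ≠ 0) : ∃ s : Fin n, w.coeff (s : ℕ) ≠ 0 :=
  ⟨⟨w.natDegree, (Polynomial.natDegree_lt_iff_degree_lt h0).2 (Polynomial.mem_degreeLT.1 hw)⟩,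
    Polynomial.leadingCoeff_ne_zero.2 h0⟩

/-- The point of the projective space that corresponds to the line spanned by a nonzero
polynomial `w` of degree less than `n`. -/
def linePoint (n : ℕ) (w : Polynomial ℂ) (hw : w ∈ Polynomial.degreeLT ℂ n) (h0 : w ≠ 0) :
    projectiveSpace n :=
  conePoint (homogeneousSubmodule (Fin n) ℂ) (aeval fun s : Fin n => w.coeff (s : ℕ))
    (X (exists_coeff_ne_zero w hw h0).choose)
    (isHomogeneous_X ℂ _)
    (by
      rw [aeval_X]
      exact (exists_coeff_ne_zero w hw h0).choose_spec)

end DiscreteWronski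

end

noncomputable section

namespace DiscreteWronski

/-! ### Morphisms of projective spectra defined by base-point-free graded homomorphisms -/

section ProjMorphism

open HomogeneousLocalization AlgebraicGeometry.Proj

universe u v

/-! The discrete Wronskian is multilinear and alternating in the polynomials of each block `i`, so
its coefficients are linear forms (`wronskiForm`) in the Segre–Plücker coordinates. The Wronski map
is therefore the restriction to the product of Grassmannians of a linear projection of the ambient
projective space. A linear projection whose center misses a projective variety is finite on it
(`exists_finite_linear_projection`): by the Nullstellensatz a power of every coordinate lies in the
ideal of the linear forms modulo the ideal of the variety, so finitely many monomials generate the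
coordinate ring over the polynomial ring in those forms.

It remains to see that the center misses the variety (`eq_zero_of_eval_wronskiForm`), which takes
two facts.

The Wronskian of bases is never zero and has degree below `wronskiDim d l`
(`wronskiPoly_ne_zero_and_mem_degreeLT`). Expanding shifts in finite differences `Δ^m`, the Wronski
matrix is a matrix of differences times an invertible confluent Vandermonde matrix. For bases with
distinct degrees, the leading part of the first factor is block diagonal, and its blocks reduce to
ordinary Vandermonde matrices in the degrees.

Every nonzero common zero of the homogeneous ideal is a multiple of the coordinate vector of an
actual tuple of subspaces (`exists_segrePlucker_eq_smul`). The exchange relations, a form of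
Cramer's rule, recover the subspaces from the coordinates near a nonvanishing one. -/

theorem _root_.GradedRingHom.apply_mem {A B σ τ : Type*} [CommRing A] [SetLike σ A] [CommRing B]
    [SetLike τ B] {𝒜 : ℕ → σ} {ℬ : ℕ → τ} (f : 𝒜 →+*ᵍ ℬ) {i : ℕ} {x : A} (hx : x ∈ 𝒜 i) :
    f x ∈ ℬ i :=
  f.map_mem hx

variable {A B σ τ : Type u} [CommRing A] [SetLike σ A] [AddSubgroupClass σ A]
  [CommRing B] [SetLike τ B] [AddSubgroupClass τ B]
  {𝒜 : ℕ → σ} {ℬ : ℕ → τ} [GradedRing 𝒜] [GradedRing ℬ]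
  (f : 𝒜 →+*ᵍ ℬ)

theorem awayMap_comp_awayMap {s t x : A} {i j : ℕ} (hs : s ∈ 𝒜 i) (ht : t ∈ 𝒜 j)
    (hx : x = s * t) (hx' : f x = f s * f t) :
    (awayMap ℬ (f.apply_mem ht) hx').comp (Away.map f s) =
      (Away.map f x).comp (awayMap 𝒜 ht hx) := by
  ext a
  obtain ⟨n, a, ha, rfl⟩ := Away.mk_surjective 𝒜 hs a
  simp only [RingHom.comp_apply, Away.map_mk, awayMap_mk, Away.val_mk, map_mul, map_pow]

/-- The affine open cover of `Proj ℬ` by the sets `D₊(g i)`. -/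
def awayCover {ι : Type v} (g : ι → B) {m : ι → ℕ} (hg : ∀ i, g i ∈ ℬ (m i)) (hm : ∀ i, 0 < m i)
    (hcov : ∀ x : Proj ℬ, ∃ i, x ∈ basicOpen ℬ (g i)) : (Proj ℬ).OpenCover :=
  Scheme.AffineOpenCover.openCover
  { I₀ := ι
    X := fun i => .of (Away ℬ (g i))
    f := fun i => awayι ℬ (g i) (hg i) (hm i)
    idx := fun x => (hcov x).choose
    covers := fun x => by
      change x ∈ (awayι ℬ _ _ _).opensRange
      rw [opensRange_awayι]
      exact (hcov x).choose_spec }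

variable {ι : Type v} {t : ι → A} {m : ι → ℕ} (ht : ∀ i, t i ∈ 𝒜 (m i)) (hm : ∀ i, 0 < m i)
  (hcov : ∀ x : Proj ℬ, ∃ i, x ∈ basicOpen ℬ (f (t i)))

/-- The morphism `Spec ℬ_(f s) ⟶ Proj 𝒜`. -/
def chartMap {s : A} {i : ℕ} (hs : s ∈ 𝒜 i) (hi : 0 < i) :
    Spec (.of (Away ℬ (f s))) ⟶ Proj 𝒜 :=
  Spec.map (CommRingCat.ofHom (Away.map f s)) ≫ awayι 𝒜 s hs hi

theorem specMap_awayMap_chartMap {s t x : A} {i j : ℕ} (hs : s ∈ 𝒜 i) (hi : 0 < i) (ht : t ∈ 𝒜 j)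
    (hx : x = s * t) (hx' : f x = f s * f t) :
    Spec.map (CommRingCat.ofHom (awayMap ℬ (f.apply_mem ht) hx')) ≫ chartMap f hs hi =
      chartMap f (hx ▸ SetLike.mul_mem_graded hs ht) (hi.trans_le (i.le_add_right j)) := by
  rw [chartMap, chartMap, ← Category.assoc, ← Spec.map_comp, ← CommRingCat.ofHom_comp,
    awayMap_comp_awayMap f hs ht hx hx', CommRingCat.ofHom_comp, Spec.map_comp, Category.assoc,
    SpecMap_awayMap_awayι]

/-- On the overlap both composites become the chart map of the product `s * t`. -/
theorem chartMap_compatible {s t : A} {i j : ℕ} (hs : s ∈ 𝒜 i) (hi : 0 < i) (ht : t ∈ 𝒜 j)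
    (hj : 0 < j) :
    Limits.pullback.fst (awayι ℬ (f s) (f.apply_mem hs) hi) (awayι ℬ (f t) (f.apply_mem ht) hj) ≫
        chartMap f hs hi =
      Limits.pullback.snd (awayι ℬ (f s) (f.apply_mem hs) hi) (awayι ℬ (f t) (f.apply_mem ht) hj) ≫
        chartMap f ht hj := by
  have hx : f (s * t) = f s * f t := map_mul f s t
  rw [← cancel_epi (pullbackAwayιIso ℬ (f.apply_mem hs) hi (f.apply_mem ht) hj hx).inv,
    pullbackAwayιIso_inv_fst_assoc, pullbackAwayιIso_inv_snd_assoc,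
    specMap_awayMap_chartMap f hs hi ht rfl hx,
    specMap_awayMap_chartMap f ht hj hs (mul_comm s t)]
  congr 1
  exact add_comm i j

/-- The morphism `Proj ℬ ⟶ Proj 𝒜` given by a graded homomorphism `f : 𝒜 → ℬ` for which the
sets `D₊(f (t i))` cover `Proj ℬ`. -/
def projMap : Proj ℬ ⟶ Proj 𝒜 :=
  (awayCover (fun i => f (t i)) (fun i => f.apply_mem (ht i)) hm hcov).glueMorphisms
    (fun i => chartMap f (ht i) (hm i))
    fun i j => chartMap_compatible f (ht i) (hm i) (ht j) (hm j)

theorem awayι_projMap (i : ι) :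
    awayι ℬ (f (t i)) (f.apply_mem (ht i)) (hm i) ≫ projMap f ht hm hcov =
      Spec.map (CommRingCat.ofHom (Away.map f (t i))) ≫ awayι 𝒜 (t i) (ht i) (hm i) :=
  (awayCover (fun i => f (t i)) (fun i => f.apply_mem (ht i)) hm hcov).ι_glueMorphisms _ _ i

/-- Equality of open sets can be tested on the covering charts, where both sides are the
nonvanishing locus of a power of `g` divided by a power of `t i`. -/
theorem projMap_preimage_basicOpen {g : A} {n : ℕ} (hg : g ∈ 𝒜 n) (hn : 0 < n) :
    projMap f ht hm hcov ⁻¹ᵁ basicOpen 𝒜 g = basicOpen ℬ (f g) := by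
  have key : ∀ i (y : Spec (.of (Away ℬ (f (t i))))),
      awayι ℬ (f (t i)) (f.apply_mem (ht i)) (hm i) y ∈
          projMap f ht hm hcov ⁻¹ᵁ basicOpen 𝒜 g ↔
        awayι ℬ (f (t i)) (f.apply_mem (ht i)) (hm i) y ∈ basicOpen ℬ (f g) := by
    intro i y
    have h1 : awayι ℬ (f (t i)) (f.apply_mem (ht i)) (hm i) ⁻¹ᵁ
        (projMap f ht hm hcov ⁻¹ᵁ basicOpen 𝒜 g) =
        awayι ℬ (f (t i)) (f.apply_mem (ht i)) (hm i) ⁻¹ᵁ basicOpen ℬ (f g) := by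
      have h2 := awayι_preimage_basicOpen 𝒜 (ht i) (hm i) hg hn
      have h3 := awayι_preimage_basicOpen ℬ (f.apply_mem (ht i)) (hm i) (f.apply_mem hg) hn
      rw [← Scheme.Hom.comp_preimage, awayι_projMap, Scheme.Hom.comp_preimage]
      refine (congrArg (Spec.map (CommRingCat.ofHom (Away.map f (t i))) ⁻¹ᵁ ·) h2).trans
        (Eq.trans ?_ h3.symm)
      ext1
      ext y
      change Away.map f (t i) _ ∉ y.asIdeal ↔ _ ∉ y.asIdeal
      rw [Away.map_mk]
      simp only [map_pow]
    exact iff_of_eq (congrArg (y ∈ ·) h1)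
  ext x
  obtain ⟨i, hi⟩ := hcov x
  rw [← opensRange_awayι ℬ _ (f.apply_mem (ht i)) (hm i)] at hi
  obtain ⟨y, rfl⟩ := hi
  exact key i y

theorem projMap_apply_eq (x : Proj ℬ) (y : Proj 𝒜)
    (h : ∀ n, ∀ g ∈ 𝒜 n, 0 < n → (g ∈ y.asHomogeneousIdeal ↔ f g ∈ x.asHomogeneousIdeal)) :
    projMap f ht hm hcov x = y := by
  have h1 : ∀ n, ∀ g ∈ 𝒜 n, 0 < n →
      (g ∈ (projMap f ht hm hcov x).asHomogeneousIdeal ↔ g ∈ y.asHomogeneousIdeal) := by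
    intro n g hg hn
    rw [h n g hg hn, ← not_iff_not, ← mem_basicOpen, ← mem_basicOpen,
      ← projMap_preimage_basicOpen f ht hm hcov hg hn]
    rfl
  obtain ⟨i, hi⟩ := hcov x
  have hx : t i ∉ (projMap f ht hm hcov x).asHomogeneousIdeal := by
    rw [← mem_basicOpen]
    rw [← projMap_preimage_basicOpen f ht hm hcov (ht i) (hm i)] at hi
    exact hi
  have hy : t i ∉ y.asHomogeneousIdeal := fun hy => hx ((h1 _ _ (ht i) (hm i)).2 hy)
  have h2 : ∀ n, ∀ g ∈ 𝒜 n,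
      (g ∈ (projMap f ht hm hcov x).asHomogeneousIdeal ↔ g ∈ y.asHomogeneousIdeal) := by
    intro n g hg
    -- Degree zero is included by multiplying with `t i`, which lies in neither prime.
    have h3 := h1 (n + m i) (g * t i) (SetLike.mul_mem_graded hg (ht i)) (by have := hm i; omega)
    constructor
    · intro hgx
      exact (y.isPrime.mem_or_mem (h3.1 (Ideal.mul_mem_right _ _ hgx))).resolve_right hy
    · intro hgy
      exact ((projMap f ht hm hcov x).isPrime.mem_or_mem
        (h3.2 (Ideal.mul_mem_right _ _ hgy))).resolve_right hx
  exact ProjectiveSpectrum.ext (HomogeneousIdeal.ext' h2)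

/-- Finiteness is local on the target, and over `D₊(t i)` the morphism is the spectrum of `Away.map
f (t i)`. -/
theorem isFinite_projMap (ht' : ∀ y : Proj 𝒜, ∃ i, y ∈ basicOpen 𝒜 (t i))
    (hfin : ∀ i, (Away.map f (t i)).Finite) : IsFinite (projMap f ht hm hcov) := by
  have hloc : IsZariskiLocalAtTarget @IsFinite.{u} :=
    @HasAffineProperty.instIsZariskiLocalAtTarget _ _
      IsFinite.instHasAffinePropertyAndIsAffineFiniteCarrierObjOppositeOpensCarrierCarrierCommRingCatPresheafOpOpensTopHomAppTop
  refine IsZariskiLocalAtTarget.of_iSup_eq_top (P := @IsFinite)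
    (fun i => basicOpen 𝒜 (t i)) ?_ fun i => ?_
  · ext y
    simpa using ht' y
  · have hpre := projMap_preimage_basicOpen f ht hm hcov (ht i) (hm i)
    have heq : projMap f ht hm hcov ∣_ basicOpen 𝒜 (t i) =
        (((Proj ℬ).isoOfEq hpre) ≪≫
          basicOpenIsoSpec ℬ (f (t i)) (f.apply_mem (ht i)) (hm i)).hom ≫
        Spec.map (CommRingCat.ofHom (Away.map f (t i))) ≫
        (basicOpenIsoSpec 𝒜 (t i) (ht i) (hm i)).inv := by
      rw [← cancel_mono (basicOpen 𝒜 (t i)).ι, morphismRestrict_ι, Category.assoc, Category.assoc,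
        basicOpenIsoSpec_inv_ι, ← awayι_projMap f ht hm hcov, awayι, Iso.trans_hom,
        Category.assoc, Category.assoc, Iso.hom_inv_id_assoc, Scheme.isoOfEq_hom_ι_assoc]
    rw [heq]
    have : IsFinite (Spec.map (CommRingCat.ofHom (Away.map f (t i)))) :=
      (IsFinite.SpecMap_iff _).2 (hfin i)
    infer_instance

end ProjMorphism

theorem projMap_structureMorphism {A B : Type} [CommRing A] [Algebra ℂ A] [CommRing B]
    [Algebra ℂ B] {𝒜 : ℕ → Submodule ℂ A} {ℬ : ℕ → Submodule ℂ B} [GradedAlgebra 𝒜]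
    [GradedAlgebra ℬ] (f : 𝒜 →+*ᵍ ℬ) (hf : ∀ c, f (algebraMap ℂ A c) = algebraMap ℂ B c)
    {ι : Type} {t : ι → A} {m : ι → ℕ} (ht : ∀ i, t i ∈ 𝒜 (m i)) (hm : ∀ i, 0 < m i)
    (hcov : ∀ x : Proj ℬ, ∃ i, x ∈ Proj.basicOpen ℬ (f (t i))) :
    projMap f ht hm hcov ≫ structureMorphism 𝒜 = structureMorphism ℬ := by
  refine (awayCover (fun i => f (t i)) (fun i => f.apply_mem (ht i)) hm hcov).hom_ext _ _
    fun (i : ι) => ?_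
  change Proj.awayι ℬ (f (t i)) (f.apply_mem (ht i)) (hm i) ≫ _ =
    Proj.awayι ℬ (f (t i)) (f.apply_mem (ht i)) (hm i) ≫ _
  rw [← Category.assoc, awayι_projMap, structureMorphism, structureMorphism, Category.assoc,
    Proj.awayι_toSpecZero_assoc, Proj.awayι_toSpecZero_assoc, ← Spec.map_comp, ← Spec.map_comp,
    ← Spec.map_comp, ← CommRingCat.ofHom_comp, ← CommRingCat.ofHom_comp, ← CommRingCat.ofHom_comp]
  congr 2
  refine RingHom.ext fun c => HomogeneousLocalization.val_injective _ ?_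
  simp only [RingHom.comp_apply, HomogeneousLocalization.fromZeroRingHom]
  change Localization.mk (f (algebraMap ℂ A c)) _ = Localization.mk (algebraMap ℂ B c) _
  rw [hf]
  congr 1
  exact Subtype.ext (map_one f)

/-! ### Finiteness -/

section Finiteness

open HomogeneousLocalization

universe u

variable {A B σ τ : Type u} [CommRing A] [SetLike σ A] [AddSubgroupClass σ A]
  [CommRing B] [SetLike τ B] [AddSubgroupClass τ B]
  {𝒜 : ℕ → σ} {ℬ : ℕ → τ} [GradedRing 𝒜] [GradedRing ℬ]
  (f : 𝒜 →+*ᵍ ℬ)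

theorem away_mk_add {s : B} {i : ℕ} (hs : s ∈ ℬ i) (n : ℕ) {x y : B} (hx : x ∈ ℬ (n • i))
    (hy : y ∈ ℬ (n • i)) :
    Away.mk ℬ hs n (x + y) (add_mem hx hy) = Away.mk ℬ hs n x hx + Away.mk ℬ hs n y hy := by
  refine val_injective _ ?_
  rw [val_add, Away.val_mk, Away.val_mk, Away.val_mk, Localization.add_mk_self]

theorem away_mk_zero {s : B} {i : ℕ} (hs : s ∈ ℬ i) (n : ℕ) :
    Away.mk ℬ hs n 0 (zero_mem _) = 0 := by
  refine val_injective _ ?_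
  rw [val_zero, Away.val_mk, Localization.mk_zero]

theorem away_mk_map_mul {s : A} {i : ℕ} (hs : s ∈ 𝒜 i) (p q : ℕ) {a : A} {c : B}
    (ha : a ∈ 𝒜 (p • i)) (hc : c ∈ ℬ (q • i)) (hac : f a * c ∈ ℬ ((p + q) • i)) :
    Away.mk ℬ (f.apply_mem hs) (p + q) (f a * c) hac =
      Away.map f s (Away.mk 𝒜 hs p a ha) * Away.mk ℬ (f.apply_mem hs) q c hc := by
  refine val_injective _ ?_
  rw [Away.map_mk, val_mul, Away.val_mk, Away.val_mk, Away.val_mk, Localization.mk_mul]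
  congr 1
  exact Subtype.ext (pow_add _ _ _)

/-- If every homogeneous element of `ℬ` is, up to multiples of degree one elements of `𝒜` by
elements of smaller degree, a combination of finitely many homogeneous elements `g k`, then the
ring homomorphism `𝒜_(s) → ℬ_(f s)` is finite for `s` of degree one. -/
theorem finite_awayMap {s : A} (hs : s ∈ 𝒜 1) {κ : Type*} [Finite κ] (g : κ → B) (e : κ → ℕ)
    (hg : ∀ k, g k ∈ ℬ (e k))
    (hgen : ∀ n, ∀ b ∈ ℬ n, b ∈ AddSubmonoid.closure
      ({x | ∃ a ∈ 𝒜 0, ∃ k, e k = n ∧ x = f a * g k} ∪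
        {x | ∃ n', n = 1 + n' ∧ ∃ a ∈ 𝒜 1, ∃ c ∈ ℬ n', x = f a * c})) :
    (Away.map f s).Finite := by
  let := (Away.map f s).toAlgebra
  have hg' : ∀ k, g k ∈ ℬ (e k • 1) := fun k => by rw [smul_eq_mul, mul_one]; exact hg k
  let M : Submodule (Away 𝒜 s) (Away ℬ (f s)) :=
    Submodule.span _ (Set.range fun k => Away.mk ℬ (f.apply_mem hs) (e k) (g k) (hg' k))
  have hmul : ∀ (r : Away 𝒜 s) (x : Away ℬ (f s)), x ∈ M → Away.map f s r * x ∈ M :=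
    fun r x hx => M.smul_mem r hx
  have key : ∀ n, ∀ b, ∀ hb : b ∈ ℬ (n • 1), Away.mk ℬ (f.apply_mem hs) n b hb ∈ M := by
    intro n
    -- A fraction `f a * c / (f s)^(1 + n')` with `a` of degree one is the image of the scalar `a /
    -- s` times a fraction of smaller exponent, so the induction descends to the generators.
    induction n using Nat.strong_induction_on with
    | _ n ih =>
    intro b hb
    have h0 : ∀ x ∈ AddSubmonoid.closure
        ({x | ∃ a ∈ 𝒜 0, ∃ k, e k = n ∧ x = f a * g k} ∪
          {x | ∃ n', n = 1 + n' ∧ ∃ a ∈ 𝒜 1, ∃ c ∈ ℬ n', x = f a * c}),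
        ∃ hx : x ∈ ℬ (n • 1), Away.mk ℬ (f.apply_mem hs) n x hx ∈ M := by
      intro x hx
      induction hx using AddSubmonoid.closure_induction with
      | zero => exact ⟨zero_mem _, by rw [away_mk_zero]; exact M.zero_mem⟩
      | add x y _ _ hx hy =>
        obtain ⟨hx, hx'⟩ := hx
        obtain ⟨hy, hy'⟩ := hy
        exact ⟨add_mem hx hy, by rw [away_mk_add _ _ hx hy]; exact M.add_mem hx' hy'⟩
      | mem x hx =>
        obtain ⟨a, ha, k, rfl, rfl⟩ | ⟨n', rfl, a, ha, c, hc, rfl⟩ := hx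
        · have h1 : f a * g k ∈ ℬ ((0 + e k) • 1) := by
            rw [smul_eq_mul, mul_one]
            exact SetLike.mul_mem_graded (f.apply_mem ha) (hg k)
          have h2 := away_mk_map_mul f hs 0 (e k) (by rwa [zero_smul]) (hg' k) h1
          have h3 := hmul _ _ (Submodule.subset_span ⟨k, rfl⟩) |> (h2 ▸ ·)
          simp only [zero_add] at h1 h3
          exact ⟨h1, h3⟩
        · have h1 : f a * c ∈ ℬ ((1 + n') • 1) := by
            rw [smul_eq_mul, mul_one]
            exact SetLike.mul_mem_graded (f.apply_mem ha) hc
          have hc' : c ∈ ℬ (n' • 1) := by rwa [smul_eq_mul, mul_one]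
          have h2 := away_mk_map_mul f hs 1 n' (by rwa [one_smul]) hc' h1
          exact ⟨h1, h2 ▸ hmul _ _ (ih n' (by omega) c hc')⟩
    exact (h0 b (hgen n b (by rwa [smul_eq_mul, mul_one] at hb))).2
  refine ⟨(Submodule.fg_def.2 ⟨_, Set.finite_range _, (eq_top_iff.2 fun x _ => ?_ : M = ⊤)⟩)⟩
  obtain ⟨n, b, hb, rfl⟩ := Away.mk_surjective ℬ (f.apply_mem hs) x
  exact key n b hb

end Finiteness

theorem mem_conePoint {A : Type} [CommRing A] [Algebra ℂ A] (𝒜 : ℕ → Submodule ℂ A)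
    [GradedAlgebra 𝒜] (χ : A →ₐ[ℂ] ℂ) (a : A) (ha : a ∈ 𝒜 1) (hχ : χ a ≠ 0) {n : ℕ} {g : A}
    (hg : g ∈ 𝒜 n) : g ∈ (conePoint 𝒜 χ a ha hχ).asHomogeneousIdeal ↔ χ g = 0 :=
  ⟨fun h => Ideal.toIdeal_homogeneousCore_le 𝒜 (RingHom.ker χ) h,
    fun h => Ideal.mem_homogeneousCore_of_homogeneous_of_mem ⟨n, hg⟩ h⟩

/-! ### Linear projections -/

theorem eval_smul_of_isHomogeneous {σ : Type*} {P : MvPolynomial σ ℂ} {e : ℕ}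
    (hP : P.IsHomogeneous e) (c : ℂ) (v : σ → ℂ) : eval (c • v) P = c ^ e * eval v P := by
  rw [eval_eq, eval_eq, Finset.mul_sum]
  refine Finset.sum_congr rfl fun α hα => ?_
  simp only [Pi.smul_apply, smul_eq_mul, mul_pow, Finset.prod_mul_distrib,
    Finset.prod_pow_eq_pow_sum]
  rw [hP.degree_eq_sum_deg_support hα]
  ring

section LinearProjection

variable {σ : Type} (C : Set (σ → ℂ)) {n : ℕ} (ℓ : Fin n → MvPolynomial σ ℂ)
  (hℓ : ∀ s, (ℓ s).IsHomogeneous 1)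

theorem mk_mem_coordGrading {P : MvPolynomial σ ℂ} {e : ℕ} (hP : P.IsHomogeneous e) :
    Ideal.Quotient.mk (homogeneousVanishingIdeal C).toIdeal P ∈ coordGrading C e :=
  Submodule.mem_map_of_mem (f := (Ideal.Quotient.mkₐ ℂ _).toLinearMap)
    ((mem_homogeneousSubmodule _ _).2 hP)

/-- The graded homomorphism from the polynomial ring to a homogeneous coordinate ring that sends
the variables to the classes of the linear forms `ℓ s`. -/
def projectionHom : homogeneousSubmodule (Fin n) ℂ →+*ᵍ coordGrading C where
  toRingHom := ((Ideal.Quotient.mkₐ ℂ (homogeneousVanishingIdeal C).toIdeal).comp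
    (aeval ℓ)).toRingHom
  map_mem {i} {P} hP := by
    refine mk_mem_coordGrading C ?_
    have h := IsHomogeneous.aeval ((mem_homogeneousSubmodule _ _).1 hP) ℓ hℓ
    rwa [one_mul] at h

theorem projectionHom_apply (P : MvPolynomial (Fin n) ℂ) :
    projectionHom C ℓ hℓ P = Ideal.Quotient.mk _ (aeval ℓ P) :=
  rfl

theorem projectionHom_X (s : Fin n) : projectionHom C ℓ hℓ (X s) = Ideal.Quotient.mk _ (ℓ s) := by
  rw [projectionHom_apply, aeval_X]

/-- Elements of degree `e` of the ideal generated by the linear forms are combinations of the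
linear forms with coefficients of degree `e - 1`. -/
theorem mem_closure_of_mem_span {e : ℕ} {b : MvPolynomial σ ℂ ⧸
      (homogeneousVanishingIdeal C).toIdeal} (hb : b ∈ coordGrading C e)
    (hb' : b ∈ Ideal.span (Set.range fun s => Ideal.Quotient.mk
      (homogeneousVanishingIdeal C).toIdeal (ℓ s))) :
    b ∈ AddSubmonoid.closure {x | ∃ e', e = 1 + e' ∧ ∃ a ∈ homogeneousSubmodule (Fin n) ℂ 1,
      ∃ c ∈ coordGrading C e', x = projectionHom C ℓ hℓ a * c} := by
  rw [Ideal.span, Submodule.mem_span_range_iff_exists_fun] at hb'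
  obtain ⟨c, hc⟩ := hb'
  have h1 : b = ∑ s, (DirectSum.decompose (coordGrading C)
      (c s * Ideal.Quotient.mk (homogeneousVanishingIdeal C).toIdeal (ℓ s)) e :
        MvPolynomial σ ℂ ⧸ (homogeneousVanishingIdeal C).toIdeal) := by
    rw [← DirectSum.decompose_of_mem_same (coordGrading C) hb, ← hc, DirectSum.decompose_sum,
      DFinsupp.finsetSum_apply]
    simp
  rw [h1]
  refine AddSubmonoid.sum_mem _ fun s _ => ?_
  by_cases he : 1 ≤ e
  · rw [DirectSum.coe_decompose_mul_of_right_mem_of_le (coordGrading C)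
      (mk_mem_coordGrading C (hℓ s)) he]
    refine AddSubmonoid.subset_closure ⟨e - 1, by omega, X s, isHomogeneous_X ℂ s,
      DirectSum.decompose (coordGrading C) (c s) (e - 1), SetLike.coe_mem _, ?_⟩
    rw [projectionHom_X, mul_comm]
  · rw [DirectSum.coe_decompose_mul_of_right_mem_of_not_le (coordGrading C)
      (mk_mem_coordGrading C (hℓ s)) he]
    exact AddSubmonoid.zero_mem _

/-- A homogeneous prime containing all variables contains every form of positive degree, hence the
irrelevant ideal, and is not a point of `Proj`. -/
theorem exists_mem_basicOpen_X (y : projectiveSpace n) :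
    ∃ s, y ∈ Proj.basicOpen (homogeneousSubmodule (Fin n) ℂ) (X s) := by
  by_contra! hy
  have h2 : ∀ s : Fin n, X s ∈ y.asHomogeneousIdeal.toIdeal := fun s => by
    have h := hy s
    rw [Proj.mem_basicOpen, not_not] at h
    exact h
  refine y.not_irrelevant_le ((HomogeneousIdeal.irrelevant_le _).2 ?_)
  intro e he P hP
  replace hP : P.IsHomogeneous e := hP
  change P ∈ y.asHomogeneousIdeal.toIdeal
  rw [P.as_sum]
  refine Ideal.sum_mem _ fun α hα => ?_
  have h3 : α ≠ 0 := by
    rintro rfl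
    have h := hP (mem_support_iff.1 hα)
    simp at h
    omega
  obtain ⟨j, hj⟩ := Finsupp.ne_iff.1 h3
  have h4 : (X j : MvPolynomial (Fin n) ℂ) ∣ monomial α (coeff α P) :=
    X_dvd_monomial.2 (Or.inr hj)
  exact Ideal.mem_of_dvd _ h4 (h2 j)

variable [Finite σ]

/-- A power of each coordinate is in the ideal generated by linear forms without common zeros
on the variety. -/
theorem exists_pow_mem_span
    (hzero : ∀ v : σ → ℂ, (∀ P ∈ (homogeneousVanishingIdeal C).toIdeal, eval v P = 0) →
      (∀ s, eval v (ℓ s) = 0) → v = 0) :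
    ∃ m : ℕ, ∀ j : σ, (Ideal.Quotient.mk (homogeneousVanishingIdeal C).toIdeal (X j)) ^ m ∈
      Ideal.span (Set.range fun s => Ideal.Quotient.mk (homogeneousVanishingIdeal C).toIdeal
        (ℓ s)) := by
  cases nonempty_fintype σ
  have h1 : ∀ j : σ, ∃ m : ℕ, (X j : MvPolynomial σ ℂ) ^ m ∈
      (homogeneousVanishingIdeal C).toIdeal ⊔ Ideal.span (Set.range ℓ) := by
    intro j
    have h2 : (X j : MvPolynomial σ ℂ) ∈
        ((homogeneousVanishingIdeal C).toIdeal ⊔ Ideal.span (Set.range ℓ)).radical := by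
      rw [← vanishingIdeal_zeroLocus_eq_radical (K := ℂ), mem_vanishingIdeal_iff]
      intro v hv
      rw [mem_zeroLocus_iff] at hv
      have h3 := hzero v
        (fun P hP => by simpa [aeval_eq_eval] using hv P (Ideal.mem_sup_left hP))
        (fun s => by
          simpa [aeval_eq_eval] using hv _ (Ideal.mem_sup_right (Ideal.subset_span ⟨s, rfl⟩)))
      rw [h3, aeval_X]
      rfl
    exact h2
  choose m hm using h1
  refine ⟨∑ j, m j, fun j => ?_⟩
  have h4 : (X j : MvPolynomial σ ℂ) ^ (∑ j, m j) ∈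
      (homogeneousVanishingIdeal C).toIdeal ⊔ Ideal.span (Set.range ℓ) :=
    Ideal.pow_mem_of_pow_mem _ (hm j) (Finset.single_le_sum (f := m) (fun _ _ => Nat.zero_le _)
      (Finset.mem_univ j))
  have h5 := Ideal.mem_map_of_mem (Ideal.Quotient.mk (homogeneousVanishingIdeal C).toIdeal) h4
  rw [Ideal.map_sup, Ideal.map_quotient_self, bot_sup_eq, Ideal.map_span, ← Set.range_comp,
    map_pow] at h5
  exact h5

/-- The generators are the monomials with all exponents below `m`. Any other monomial is divisible
by some `X j ^ m`, so it lies in the ideal of the linear forms and reduces to smaller degree. -/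
theorem finite_awayMap_projectionHom
    (hzero : ∀ v : σ → ℂ, (∀ P ∈ (homogeneousVanishingIdeal C).toIdeal, eval v P = 0) →
      (∀ s, eval v (ℓ s) = 0) → v = 0) (s : Fin n) :
    (HomogeneousLocalization.Away.map (projectionHom C ℓ hℓ) (X s)).Finite := by
  classical
  cases nonempty_fintype σ
  obtain ⟨m, hm⟩ := exists_pow_mem_span C ℓ hzero
  refine finite_awayMap (projectionHom C ℓ hℓ) (isHomogeneous_X ℂ s)
    (κ := σ → Fin m) (fun α => Ideal.Quotient.mk _ (∏ j, X j ^ (α j : ℕ)))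
    (fun α => ∑ j, (α j : ℕ)) (fun α => mk_mem_coordGrading C ?_) ?_
  · refine IsHomogeneous.prod _ _ _ fun j _ => ?_
    exact isHomogeneous_X_pow j _
  rintro e _ ⟨P, hP, rfl⟩
  replace hP : P.IsHomogeneous e := hP
  change Ideal.Quotient.mk _ P ∈ _
  rw [P.as_sum, map_sum]
  refine AddSubmonoid.sum_mem _ fun α hα => ?_
  have hdeg : ∑ j, α j = e := by
    have h := hP (mem_support_iff.1 hα)
    rw [Finsupp.weight_apply, Finsupp.sum_fintype _ _ (by simp)] at h
    simpa using h
  have hmon : monomial α (coeff α P) = MvPolynomial.C (coeff α P) * ∏ j, X j ^ (α j : ℕ) := by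
    rw [monomial_eq, Finsupp.prod_fintype _ _ (by simp)]
  rw [hmon]
  by_cases hlt : ∀ j, α j < m
  · refine AddSubmonoid.subset_closure (Or.inl ⟨MvPolynomial.C (coeff α P), isHomogeneous_C _ _,
      fun j => ⟨α j, hlt j⟩, hdeg, ?_⟩)
    rw [map_mul, projectionHom_apply, aeval_C]
    rfl
  · push Not at hlt
    obtain ⟨j, hj⟩ := hlt
    refine AddSubmonoid.closure_mono Set.subset_union_right
      (mem_closure_of_mem_span C ℓ hℓ ?_ ?_)
    · refine mk_mem_coordGrading C ?_
      rw [← hmon]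
      exact isHomogeneous_monomial _ (by rw [← hdeg, Finsupp.degree_eq_sum])
    · rw [map_mul]
      refine Ideal.mul_mem_left _ _ ?_
      rw [map_prod, ← Finset.mul_prod_erase _ _ (Finset.mem_univ j), map_pow]
      exact Ideal.mul_mem_right _ _ (Ideal.mem_of_dvd _ (pow_dvd_pow _ hj) (hm j))

/-- A prime containing all the linear forms would contain a power of each coordinate, hence the
coordinates themselves and the irrelevant ideal. -/
theorem exists_mem_basicOpen_projectionHom
    (hzero : ∀ v : σ → ℂ, (∀ P ∈ (homogeneousVanishingIdeal C).toIdeal, eval v P = 0) →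
      (∀ s, eval v (ℓ s) = 0) → v = 0) (x : projectiveVariety C) :
    ∃ s, x ∈ Proj.basicOpen (coordGrading C) (projectionHom C ℓ hℓ (X s)) := by
  classical
  obtain ⟨m, hm⟩ := exists_pow_mem_span C ℓ hzero
  by_contra! hx
  have h1 : ∀ s, Ideal.Quotient.mk (homogeneousVanishingIdeal C).toIdeal (ℓ s) ∈
      x.asHomogeneousIdeal.toIdeal := fun s => by
    have h := hx s
    rw [Proj.mem_basicOpen, not_not, projectionHom_X] at h
    exact h
  have h2 : ∀ j : σ, Ideal.Quotient.mk (homogeneousVanishingIdeal C).toIdeal (X j) ∈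
      x.asHomogeneousIdeal.toIdeal := fun j =>
    x.isPrime.mem_of_pow_mem m
      (Ideal.span_le.2 (Set.range_subset_iff.2 h1) (hm j))
  refine x.not_irrelevant_le ((HomogeneousIdeal.irrelevant_le _).2 ?_)
  rintro e he _ ⟨P, hP, rfl⟩
  replace hP : P.IsHomogeneous e := hP
  change Ideal.Quotient.mk _ P ∈ x.asHomogeneousIdeal.toIdeal
  rw [P.as_sum, map_sum]
  refine Ideal.sum_mem _ fun α hα => ?_
  have h3 : α ≠ 0 := by
    rintro rfl
    have h := hP (mem_support_iff.1 hα)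
    simp at h
    omega
  obtain ⟨j, hj⟩ := Finsupp.ne_iff.1 h3
  have h4 : (X j : MvPolynomial σ ℂ) ∣ monomial α (coeff α P) :=
    X_dvd_monomial.2 (Or.inr hj)
  exact Ideal.mem_of_dvd _ (map_dvd _ h4) (h2 j)

/-- A linear projection whose center is disjoint from a projective variety restricts to a finite
morphism on the variety. -/
theorem exists_finite_linear_projection (hℓ : ∀ s, (ℓ s).IsHomogeneous 1)
    (hzero : ∀ v : σ → ℂ, (∀ P ∈ (homogeneousVanishingIdeal C).toIdeal, eval v P = 0) →
      (∀ s, eval v (ℓ s) = 0) → v = 0) :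
    ∃ φ : projectiveVariety C ⟶ projectiveSpace n,
      φ ≫ structureMorphism (homogeneousSubmodule (Fin n) ℂ) =
        structureMorphism (coordGrading C) ∧
      IsFinite φ ∧
      ∀ (v : σ → ℂ) (hv : v ∈ C) (h0 : ∃ s, v s ≠ 0) (w : Polynomial ℂ)
        (hw : w ∈ Polynomial.degreeLT ℂ n) (hw0 : w ≠ 0) (c : ℂ),
        (∀ s : Fin n, c * eval v (ℓ s) = w.coeff s) →
        φ (varietyPoint C v hv h0) = linePoint n w hw hw0 := by
  refine ⟨projMap (projectionHom C ℓ hℓ) (t := X) (m := fun _ => 1) (fun s => isHomogeneous_X ℂ s)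
    (fun _ => one_pos) (exists_mem_basicOpen_projectionHom C ℓ hℓ hzero), ?_, ?_, ?_⟩
  · refine projMap_structureMorphism _ (fun c => ?_) _ _ _
    exact ((Ideal.Quotient.mkₐ ℂ (homogeneousVanishingIdeal C).toIdeal).comp
      (aeval ℓ)).commutes c
  · exact isFinite_projMap _ _ _ _ exists_mem_basicOpen_X
      (finite_awayMap_projectionHom C ℓ hℓ hzero)
  · intro v hv h0 w hw hw0 c hc
    have hc0 : c ≠ 0 := by
      rintro rfl
      obtain ⟨s, hs⟩ := exists_coeff_ne_zero w hw hw0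
      exact hs (by rw [← hc s, zero_mul])
    refine projMap_apply_eq _ _ _ _ _ _ fun e g hg he => ?_
    refine (mem_conePoint _ _ _ _ _ hg).trans
      (Iff.trans ?_ (mem_conePoint _ _ _ _ _ ((projectionHom C ℓ hℓ).apply_mem hg)).symm)
    have h1 : coordEval C v hv (projectionHom C ℓ hℓ g) = eval (fun s => eval v (ℓ s)) g := by
      change aeval v (aeval ℓ g) = _
      rw [← AlgHom.comp_apply, comp_aeval]
      simp only [aeval_eq_eval]
    have h2 : (aeval fun s : Fin n => w.coeff (s : ℕ)) g =
        c ^ e * eval (fun s => eval v (ℓ s)) g := by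
      have h3 : (fun s : Fin n => w.coeff (s : ℕ)) = c • fun s => eval v (ℓ s) := by
        ext s
        exact (hc s).symm
      rw [h3, aeval_eq_eval]
      exact eval_smul_of_isHomogeneous ((mem_homogeneousSubmodule _ _).1 hg) c _
    rw [h1, h2]
    simp [hc0]

end LinearProjection

/-! ### Finite differences of polynomials -/

section Differences

open Polynomial

/-- The forward difference operator `p(x) ↦ p(x + 1) - p(x)`. -/
def polyDiff : Module.End ℂ ℂ[X] :=
  taylor 1 - 1

theorem taylor_one_pow (c : ℕ) : (taylor (1 : ℂ) : Module.End ℂ ℂ[X]) ^ c = taylor (c : ℂ) := by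
  induction c with
  | zero => simp [Module.End.one_eq_id]
  | succ c ih =>
    rw [pow_succ', ih]
    refine LinearMap.ext fun p => ?_
    rw [Module.End.mul_apply, taylor_taylor]
    push_cast
    rw [add_comm]

/-- Newton's expansion of the shift as `(1 + Δ)^c`. The range `N` does not depend on `c`, because
the extra binomials vanish; this lets all columns of the Wronski matrix share the same differences.
-/
theorem taylor_natCast_eq_sum {N c : ℕ} (hc : c < N) (p : ℂ[X]) :
    taylor (c : ℂ) p = ∑ m ∈ Finset.range N, Polynomial.C (c.choose m : ℂ) * (polyDiff ^ m) p := by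
  have h1 : (taylor (1 : ℂ) : Module.End ℂ ℂ[X]) = polyDiff + 1 := by simp [polyDiff]
  rw [← taylor_one_pow, h1, (Commute.one_right polyDiff).add_pow, LinearMap.sum_apply]
  have h2 : Finset.range (c + 1) ⊆ Finset.range N := Finset.range_mono hc
  rw [← Finset.sum_subset h2]
  · refine Finset.sum_congr rfl fun m _ => ?_
    rw [one_pow, mul_one, ← nsmul_eq_mul', LinearMap.smul_apply, nsmul_eq_mul]
    simp
  · intro m _ hm
    rw [Finset.mem_range, not_lt] at hm
    rw [Nat.choose_eq_zero_of_lt hm]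
    simp

/-- Coefficient `a` of the shifted polynomial is the value at `1` of the `a`-th Hasse derivative,
here of degree at most one; its constant term cancels against `q.coeff a`. -/
theorem coeff_polyDiff {a : ℕ} {q : ℂ[X]} (hq : ∀ b, a + 1 < b → q.coeff b = 0) :
    (polyDiff q).coeff a = (a + 1) * q.coeff (a + 1) := by
  have h1 : (hasseDeriv a q).natDegree < 2 := by
    have h2 : q.natDegree ≤ a + 1 := natDegree_le_iff_coeff_eq_zero.2 hq
    have h3 := natDegree_hasseDeriv_le q a
    omega
  change (taylor 1 q - q).coeff a = _
  rw [Polynomial.coeff_sub, taylor_coeff, eval_eq_sum_range' h1, Finset.sum_range_succ,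
    Finset.sum_range_one, hasseDeriv_coeff, hasseDeriv_coeff]
  simp [add_comm 1 a]

/-- Each difference lowers the degree by one and multiplies the top coefficient by the current
degree. Writing the conditions with `a + m` avoids truncated subtraction and covers `m > e`, where
the difference is zero. -/
theorem coeff_polyDiff_pow {e : ℕ} {p : ℂ[X]} (hp : ∀ b, e < b → p.coeff b = 0) (m : ℕ) :
    (∀ a, e < a + m → ((polyDiff ^ m) p).coeff a = 0) ∧
      ∀ a, a + m = e → ((polyDiff ^ m) p).coeff a = e.descFactorial m * p.coeff e := by
  induction m with
  | zero => exact ⟨fun a ha => hp a ha, fun a ha => by simp at ha; simp [ha]⟩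
  | succ m ih =>
    obtain ⟨ih1, ih2⟩ := ih
    constructor
    · intro a ha
      rw [pow_succ', Module.End.mul_apply, coeff_polyDiff fun b hb => ih1 b (by omega),
        ih1 (a + 1) (by omega), mul_zero]
    · intro a ha
      rw [pow_succ', Module.End.mul_apply, coeff_polyDiff fun b hb => ih1 b (by omega),
        ih2 (a + 1) (by omega), Nat.descFactorial_succ]
      have : e - m = a + 1 := by omega
      rw [this]
      push_cast
      ring

end Differences

/-! ### Determinants of polynomial matrices -/

section DetDegree

open Polynomial

theorem natDegree_prod_le_sum {ι : Type*} (s : Finset ι) (f : ι → ℂ[X]) (a : ι → ℕ)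
    (h : ∀ i ∈ s, (f i).natDegree ≤ a i) : (∏ i ∈ s, f i).natDegree ≤ ∑ i ∈ s, a i :=
  (natDegree_prod_le s f).trans (Finset.sum_le_sum h)

theorem coeff_prod_sum {ι : Type*} (s : Finset ι) (f : ι → ℂ[X]) (a : ι → ℕ)
    (h : ∀ i ∈ s, (f i).natDegree ≤ a i) :
    (∏ i ∈ s, f i).coeff (∑ i ∈ s, a i) = ∏ i ∈ s, (f i).coeff (a i) := by
  classical
  induction s using Finset.induction_on with
  | empty => simp
  | insert i s hi ih =>
    rw [Finset.prod_insert hi, Finset.sum_insert hi, Finset.prod_insert hi,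
      coeff_mul_add_eq_of_natDegree_le (h i (Finset.mem_insert_self i s))
        (natDegree_prod_le_sum s f a fun j hj => h j (Finset.mem_insert_of_mem hj)),
      ih fun j hj => h j (Finset.mem_insert_of_mem hj)]

variable {ι : Type*} [Fintype ι] [DecidableEq ι] (A : Matrix ι ι ℂ[X]) (a β : ι → ℕ)

theorem natDegree_det_le_sum (h : ∀ r c, (A r c).natDegree ≤ a r + β c) :
    A.det.natDegree ≤ ∑ r, a r + ∑ c, β c := by
  rw [Matrix.det_apply]
  refine natDegree_sum_le_of_forall_le _ _ fun σ _ => ?_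
  refine (natDegree_smul_le _ _).trans
    ((natDegree_prod_le_sum _ _ (fun i => a (σ i) + β i) fun i _ => h _ _).trans_eq ?_)
  rw [Finset.sum_add_distrib, Equiv.sum_comp σ a]

/-- With row and column weights, every Leibniz term has the same degree bound, so the top
coefficient of the determinant is the determinant of the top coefficients. -/
theorem coeff_det_sum (h : ∀ r c, (A r c).natDegree ≤ a r + β c) :
    A.det.coeff (∑ r, a r + ∑ c, β c) = (Matrix.of fun r c => (A r c).coeff (a r + β c)).det := by
  rw [Matrix.det_apply, Matrix.det_apply, finsetSum_coeff]
  refine Finset.sum_congr rfl fun σ _ => ?_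
  have h1 : ∑ r, a r + ∑ c, β c = ∑ i, (a (σ i) + β i) := by
    rw [Finset.sum_add_distrib, Equiv.sum_comp σ a]
  rw [Polynomial.coeff_smul, h1, coeff_prod_sum _ _ (fun i => a (σ i) + β i) fun i _ => h _ _]
  rfl

end DetDegree

theorem det_blockDiagonal'_ne_zero {o : Type*} [Fintype o] [DecidableEq o] {m : o → Type*}
    [∀ i, Fintype (m i)] [∀ i, DecidableEq (m i)] (T : ∀ i, Matrix (m i) (m i) ℂ)
    (hT : ∀ i, (T i).det ≠ 0) : (Matrix.blockDiagonal' T).det ≠ 0 := by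
  have h : Matrix.blockDiagonal' T * Matrix.blockDiagonal' (fun i => (T i)⁻¹) = 1 := by
    rw [← Matrix.blockDiagonal'_mul, ← Matrix.blockDiagonal'_one]
    congr 1
    funext i
    exact Matrix.mul_nonsing_inv _ (hT i).isUnit
  intro h0
  have h1 := congrArg Matrix.det h
  rw [Matrix.det_mul, h0, zero_mul, Matrix.det_one] at h1
  exact zero_ne_one h1

/-! ### The confluent Vandermonde matrix -/

section Confluent

open Polynomial

variable {k : ℕ} (d : Fin k → ℕ) (Q : Fin k → ℂ)

/-- The vector `(binom(c, m) Q^c)`, where the number `c < ∑ d_i` is encoded by an element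
of `Σ i, Fin (d i)`. -/
def confluentRow (i : Fin k) (m : ℕ) (c : Σ i : Fin k, Fin (d i)) : ℂ :=
  ((finSigmaFinEquiv c : ℕ).choose m : ℂ) * Q i ^ (finSigmaFinEquiv c : ℕ)

/-- The confluent Vandermonde matrix with nodes `Q i` of multiplicities `d i`. -/
def confluentVandermonde : Matrix (Σ i : Fin k, Fin (d i)) (Σ i : Fin k, Fin (d i)) ℂ :=
  Matrix.of fun r c => confluentRow d Q r.1 r.2 c

/-- Hermite interpolation: a kernel vector is the coefficient vector of a polynomial of degree less
than `∑ d i`. Row `(i, m)` is `Q i ^ m` times the `m`-th Hasse derivative at `Q i`, so this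
polynomial vanishes to order `d i` at each of the distinct points `Q i` and is zero. -/
theorem det_confluentVandermonde_ne_zero (hQ : Function.Injective Q) (h0 : ∀ i, Q i ≠ 0) :
    (confluentVandermonde d Q).det ≠ 0 := by
  intro hdet
  obtain ⟨v, hv0, hv⟩ := Matrix.exists_mulVec_eq_zero_iff.2 hdet
  apply hv0
  let P : ℂ[X] := ∑ c, Polynomial.C (v c) * Polynomial.X ^ (finSigmaFinEquiv c : ℕ)
  have hcoeff : ∀ c, P.coeff (finSigmaFinEquiv c : ℕ) = v c := by
    intro c
    rw [finsetSum_coeff, Finset.sum_eq_single c]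
    · simp
    · intro b _ hb
      rw [coeff_C_mul_X_pow, if_neg]
      intro h
      exact hb (finSigmaFinEquiv.injective (Fin.ext h)).symm
    · simp
  have hdeg : P.degree < (∑ i, d i : ℕ) := by
    refine (degree_sum_le _ _).trans_lt ((Finset.sup_lt_iff (WithBot.bot_lt_coe _)).2 fun c _ => ?_)
    exact (degree_C_mul_X_pow_le _ _).trans_lt (by exact_mod_cast (finSigmaFinEquiv c).2)
  have hdvd : ∀ i, (Polynomial.X - Polynomial.C (Q i)) ^ d i ∣ P := by
    intro i
    rw [X_sub_C_pow_dvd_iff, X_pow_dvd_iff]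
    intro m hm
    have h1 : (hasseDeriv m P).eval (Q i) * Q i ^ m = 0 := by
      have h2 := congrFun hv ⟨i, ⟨m, hm⟩⟩
      rw [Matrix.mulVec, dotProduct, Pi.zero_apply] at h2
      rw [← h2, map_sum, eval_finsetSum, Finset.sum_mul]
      refine Finset.sum_congr rfl fun c _ => ?_
      rw [Polynomial.C_mul_X_pow_eq_monomial, hasseDeriv_monomial, Polynomial.eval_monomial]
      change _ = ((finSigmaFinEquiv c : ℕ).choose m : ℂ) * Q i ^ (finSigmaFinEquiv c : ℕ) * v c
      by_cases hmc : m ≤ (finSigmaFinEquiv c : ℕ)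
      · rw [mul_assoc, ← pow_add, Nat.sub_add_cancel hmc]
        ring
      · rw [Nat.choose_eq_zero_of_lt (not_le.1 hmc)]
        simp
    change (taylor (Q i) P).coeff m = 0
    rw [taylor_coeff]
    exact (mul_eq_zero.1 h1).resolve_right (pow_ne_zero _ (h0 i))
  have hprod : ∏ i, (Polynomial.X - Polynomial.C (Q i)) ^ d i ∣ P := by
    refine Finset.prod_dvd_of_coprime (fun i _ j _ hij => ?_) fun i _ => hdvd i
    exact (isCoprime_X_sub_C_of_isUnit_sub (sub_ne_zero.2 (hQ.ne hij)).isUnit).pow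
  have hP : P = 0 := by
    by_contra hP
    have h3 := degree_le_of_dvd hprod hP
    rw [degree_prod] at h3
    simp only [degree_pow, degree_X_sub_C, nsmul_one] at h3
    refine absurd (h3.trans_lt hdeg) (not_lt.2 (le_of_eq ?_))
    push_cast
    rfl
  funext c
  rw [← hcoeff c, hP]
  rfl

end Confluent

/-! ### The discrete Wronskian as a polynomial -/

section WronskiPoly

open Polynomial

variable {k : ℕ} (d : Fin k → ℕ) (Q : Fin k → ℂ)

/-- The matrix `(Q_i^c p_{i,j}(x + c))`, with rows indexed by the pairs `(i, j)` and columns by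
the numbers `c < ∑ d_i`. -/
def wronskiMatrix (p : (i : Fin k) → Fin (d i) → ℂ[X]) :
    Matrix (Σ i : Fin k, Fin (d i)) (Σ i : Fin k, Fin (d i)) ℂ[X] :=
  Matrix.of fun r c => Polynomial.C (Q r.1 ^ (finSigmaFinEquiv c : ℕ)) *
    taylor ((finSigmaFinEquiv c : ℕ) : ℂ) (p r.1 r.2)

/-- The polynomial `Wr^d(p_{1,1} Q_1^x, …, p_{k,d_k} Q_k^x) ∏ Q_i^{- d_i x}`. -/
def wronskiPoly (p : (i : Fin k) → Fin (d i) → ℂ[X]) : ℂ[X] :=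
  (wronskiMatrix d Q p).det

/-- The factor `exp (L i * x)` comes out of each of the `d i` rows of block `i`, and the normalizing
product cancels it. -/
theorem eval_wronskiPoly (L : Fin k → ℂ) (hL : ∀ i, Complex.exp (L i) = Q i)
    (p : (i : Fin k) → Fin (d i) → ℂ[X]) (x : ℂ) :
    (wronskiPoly d Q p).eval x =
      discreteWronskian (quasiExpFamily d L p) x *
        ∏ i, Complex.exp (-((d i : ℂ) * L i * x)) := by
  have h1 : discreteWronskian (quasiExpFamily d L p) x =
      (Matrix.of fun r c : Σ i : Fin k, Fin (d i) => Complex.exp (L r.1 * x) *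
        (wronskiMatrix d Q p r c).eval x).det := by
    rw [discreteWronskian, ← Matrix.det_submatrix_equiv_self finSigmaFinEquiv]
    congr 1
    ext r c
    have h : quasiExpFamily d L p (finSigmaFinEquiv r) = quasiExp (p r.1 r.2) (L r.1) := by
      rw [quasiExpFamily, Equiv.symm_apply_apply]
    simp only [Matrix.submatrix_apply, Matrix.of_apply, h, quasiExp, wronskiMatrix,
      Polynomial.eval_mul, Polynomial.eval_C, taylor_eval]
    rw [mul_add, Complex.exp_add, ← hL, ← Complex.exp_nat_mul, mul_comm (L r.1) (_ : ℂ)]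
    ring_nf
  have h2 : (∏ r : Σ i : Fin k, Fin (d i), Complex.exp (L r.1 * x)) *
      ∏ i, Complex.exp (-((d i : ℂ) * L i * x)) = 1 := by
    rw [Fintype.prod_sigma, ← Finset.prod_mul_distrib]
    refine Finset.prod_eq_one fun i _ => ?_
    dsimp only
    rw [Finset.prod_const, Finset.card_univ, Fintype.card_fin, ← Complex.exp_nat_mul,
      ← Complex.exp_add, ← Complex.exp_zero]
    congr 1
    ring
  have h3 : (wronskiPoly d Q p).eval x =
      (Matrix.of fun r c => (wronskiMatrix d Q p r c).eval x).det := by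
    rw [wronskiPoly, ← coe_evalRingHom, RingHom.map_det]
    rfl
  have h4 := Matrix.det_mul_column (fun r : Σ i : Fin k, Fin (d i) => Complex.exp (L r.1 * x))
    (Matrix.of fun r c => (wronskiMatrix d Q p r c).eval x)
  simp only [Matrix.of_apply] at h4
  rw [h1, h4, mul_right_comm, h2, one_mul, h3]

/-- A change of bases multiplies the Wronskian by a constant. -/
theorem wronskiPoly_change_basis (T : ∀ i, Matrix (Fin (d i)) (Fin (d i)) ℂ)
    (p q : (i : Fin k) → Fin (d i) → ℂ[X]) (h : ∀ i j, p i j = ∑ j', T i j j' • q i j') :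
    wronskiPoly d Q p = Polynomial.C (Matrix.blockDiagonal' T).det * wronskiPoly d Q q := by
  rw [wronskiPoly, wronskiPoly, RingHom.map_det, ← Matrix.det_mul]
  congr 1
  ext1 ⟨i, j⟩ c
  rw [Matrix.mul_apply, Fintype.sum_sigma, Finset.sum_eq_single i]
  · simp only [wronskiMatrix, Matrix.of_apply, h, map_sum, map_smul, Finset.mul_sum,
      RingHom.mapMatrix_apply, Matrix.map_apply, Matrix.blockDiagonal'_apply_eq]
    refine Finset.sum_congr rfl fun j' _ => ?_
    rw [Polynomial.smul_eq_C_mul]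
    ring
  · intro i' _ hi
    refine Finset.sum_eq_zero fun j' _ => ?_
    rw [RingHom.mapMatrix_apply, Matrix.map_apply, Matrix.blockDiagonal'_apply_ne _ _ _ hi.symm,
      map_zero, zero_mul]
  · simp

variable {d Q}

/-- The coordinates of the vectors `confluentRow d Q i m` in the basis formed by the rows of the
confluent Vandermonde matrix. -/
def confluentCoord (d : Fin k → ℕ) (Q : Fin k → ℂ) (i : Fin k) (m : ℕ) :
    (Σ i : Fin k, Fin (d i)) → ℂ :=
  Matrix.vecMul (confluentRow d Q i m) (confluentVandermonde d Q)⁻¹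

theorem confluentCoord_vecMul (hdet : (confluentVandermonde d Q).det ≠ 0) (i : Fin k) (m : ℕ) :
    Matrix.vecMul (confluentCoord d Q i m) (confluentVandermonde d Q) = confluentRow d Q i m := by
  rw [confluentCoord, Matrix.vecMul_vecMul, Matrix.nonsing_inv_mul _ hdet.isUnit, Matrix.vecMul_one]

theorem confluentCoord_of_lt (hdet : (confluentVandermonde d Q).det ≠ 0) (i : Fin k) {m : ℕ}
    (hm : m < d i) : confluentCoord d Q i m = Pi.single ⟨i, ⟨m, hm⟩⟩ 1 := by
  have h : confluentRow d Q i m =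
      Matrix.vecMul (Pi.single ⟨i, ⟨m, hm⟩⟩ 1) (confluentVandermonde d Q) := by
    rw [Matrix.single_one_vecMul]
    rfl
  rw [confluentCoord, h, Matrix.vecMul_vecMul, Matrix.mul_nonsing_inv _ hdet.isUnit,
    Matrix.vecMul_one]

/-- The product of the Wronski matrix and the inverse of the confluent Vandermonde matrix. -/
def reducedMatrix (d : Fin k → ℕ) (Q : Fin k → ℂ) (p : (i : Fin k) → Fin (d i) → ℂ[X]) :
    Matrix (Σ i : Fin k, Fin (d i)) (Σ i : Fin k, Fin (d i)) ℂ[X] :=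
  Matrix.of fun r c => ∑ m ∈ Finset.range (∑ i, d i),
    Polynomial.C (confluentCoord d Q r.1 m c) * (polyDiff ^ m) (p r.1 r.2)

/-- Newton's expansion writes row `(i, j)` as the sum of `Δ^m (p i j)` times `confluentRow d Q i m`.
The vectors with `m < d i` are rows of the confluent Vandermonde matrix, and those with `m ≥ d i`
are expressed through all of its rows. -/
theorem wronskiMatrix_eq_mul (hdet : (confluentVandermonde d Q).det ≠ 0)
    (p : (i : Fin k) → Fin (d i) → ℂ[X]) :
    wronskiMatrix d Q p =
      reducedMatrix d Q p * Polynomial.C.mapMatrix (confluentVandermonde d Q) := by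
  ext1 r c
  have h1 : ∀ m, ∑ c', Polynomial.C (confluentCoord d Q r.1 m c') *
      Polynomial.C (confluentVandermonde d Q c' c) =
      Polynomial.C (confluentRow d Q r.1 m c) := by
    intro m
    rw [← confluentCoord_vecMul hdet, Matrix.vecMul, dotProduct, map_sum]
    simp only [map_mul]
  rw [Matrix.mul_apply]
  simp only [reducedMatrix, Matrix.of_apply, RingHom.mapMatrix_apply, Matrix.map_apply,
    Finset.sum_mul]
  rw [Finset.sum_comm]
  simp only [mul_right_comm _ ((polyDiff ^ _) _) _, ← Finset.sum_mul, h1]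
  rw [wronskiMatrix, Matrix.of_apply, taylor_natCast_eq_sum (finSigmaFinEquiv c).2,
    Finset.mul_sum]
  refine Finset.sum_congr rfl fun m _ => ?_
  rw [confluentRow, map_mul]
  ring

/-- The degrees and the leading coefficients of the entries of the reduced matrix, with row
`(i, j)` multiplied by `X ^ d i`. -/
theorem coeff_reducedMatrix (hdet : (confluentVandermonde d Q).det ≠ 0)
    (p : (i : Fin k) → Fin (d i) → ℂ[X]) (r c : Σ i : Fin k, Fin (d i)) (b : ℕ)
    (hb : (p r.1 r.2).natDegree + (d c.1 - c.2) ≤ b) :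
    (Polynomial.X ^ d r.1 * reducedMatrix d Q p r c).coeff b =
      if r.1 = c.1 ∧ b = (p r.1 r.2).natDegree + (d c.1 - c.2) then
        ((p r.1 r.2).natDegree.descFactorial c.2 : ℂ) * (p r.1 r.2).leadingCoeff else 0 := by
  obtain ⟨i, j⟩ := r
  obtain ⟨i', m'⟩ := c
  dsimp only at hb ⊢
  have hm' := m'.2
  set q := p i j with hq
  have hvan : ∀ b, q.natDegree < b → q.coeff b = 0 := fun b hb => coeff_eq_zero_of_natDegree_lt hb
  have hterm : ∀ m : ℕ, (Polynomial.X ^ d i * (Polynomial.C (confluentCoord d Q i m ⟨i', m'⟩) *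
      (polyDiff ^ m) q)).coeff b = if i = i' ∧ m = m' then
        (if b = q.natDegree + (d i' - m') then
          (q.natDegree.descFactorial m' : ℂ) * q.leadingCoeff else 0) else 0 := by
    intro m
    obtain ⟨hv1, hv2⟩ := coeff_polyDiff_pow hvan m
    rw [coeff_X_pow_mul']
    by_cases hm : m < d i
    · rw [confluentCoord_of_lt hdet i hm]
      by_cases him : i = i' ∧ m = m'
      · obtain ⟨rfl, rfl⟩ := him
        rw [if_pos (show i = i ∧ (m' : ℕ) = m' from ⟨rfl, rfl⟩), Pi.single_eq_same, map_one, one_mul]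
        split_ifs with h1 h2 h2
        · rw [hv2 _ (by omega)]
          rfl
        · exact hv1 _ (by omega)
        -- Here `b < d i`, which forces the degree of `q` to be below `m'`, so the falling factorial
        -- vanishes.
        · rw [Nat.descFactorial_eq_zero_iff_lt.2 (by omega)]
          simp
        · rfl
      · rw [if_neg him, Pi.single_eq_of_ne, map_zero, zero_mul, Polynomial.coeff_zero, ite_self]
        intro h
        apply him
        rw [Sigma.mk.injEq] at h
        obtain ⟨rfl, h2⟩ := h
        have := eq_of_heq h2
        exact ⟨rfl, by rw [this]⟩
    -- For `m ≥ d i` the difference loses at least the `d i` degrees restored by the factor `X ^ d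
    -- i`, while `b` exceeds the degree of `q` since `m' < d i'`. These terms never reach the
    -- leading part.
    · rw [if_neg (show ¬(i = i' ∧ m = m') by rintro ⟨rfl, rfl⟩; exact hm hm')]
      split_ifs with h1
      · rw [Polynomial.coeff_C_mul, hv1 _ (by omega), mul_zero]
      · rfl
  rw [reducedMatrix, Matrix.of_apply, Finset.mul_sum, finsetSum_coeff]
  simp only [hterm, ← hq]
  by_cases hi : i = i'
  · subst hi
    have hmem : (m' : ℕ) ∈ Finset.range (∑ i, d i) :=
      Finset.mem_range.2 (hm'.trans_le (Finset.single_le_sum (fun _ _ => Nat.zero_le _)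
        (Finset.mem_univ i)))
    rw [Finset.sum_eq_single_of_mem _ hmem fun b _ hb => by simp [hb]]
    simp
  · simp [hi]

/-- For bases with distinct degrees, the Wronskian is nonzero and its degree is bounded by the
expected number. -/
theorem wronskiPoly_of_injective_natDegree (hQ : Function.Injective Q) (h0 : ∀ i, Q i ≠ 0)
    (p : (i : Fin k) → Fin (d i) → ℂ[X]) (hp0 : ∀ i j, p i j ≠ 0)
    (hp : ∀ i, Function.Injective fun j => (p i j).natDegree) :
    wronskiPoly d Q p ≠ 0 ∧ (wronskiPoly d Q p).natDegree + ∑ i, d i ^ 2 ≤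
      ∑ i, ((∑ j, (p i j).natDegree) + ∑ m : Fin (d i), (d i - m)) := by
  have hdet := det_confluentVandermonde_ne_zero d Q hQ h0
  -- The factor `X ^ d i` makes the column weights `d i' - m'` nonnegative. Over the `d i` rows of
  -- each block it contributes `∑ d i ^ 2`, the number subtracted in `wronskiDim`.
  let A : Matrix (Σ i : Fin k, Fin (d i)) (Σ i : Fin k, Fin (d i)) ℂ[X] :=
    Matrix.of fun r c => Polynomial.X ^ d r.1 * reducedMatrix d Q p r c
  have hA : ∀ r c, (A r c).natDegree ≤ (p r.1 r.2).natDegree + (d c.1 - c.2) := by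
    intro r c
    refine natDegree_le_iff_coeff_eq_zero.2 fun b hb => ?_
    refine (coeff_reducedMatrix hdet p r c b hb.le).trans (if_neg ?_)
    rintro ⟨-, h⟩
    omega
  have hAdet : A.det * Polynomial.C (confluentVandermonde d Q).det =
      Polynomial.X ^ (∑ i, d i ^ 2) * wronskiPoly d Q p := by
    rw [wronskiPoly, wronskiMatrix_eq_mul hdet, Matrix.det_mul, RingHom.map_det,
      Matrix.det_mul_column (fun r : Σ i : Fin k, Fin (d i) => (Polynomial.X : ℂ[X]) ^ d r.1),
      Fintype.prod_sigma]
    have h1 : ∏ i : Fin k, ∏ _j : Fin (d i), (Polynomial.X : ℂ[X]) ^ d i =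
        Polynomial.X ^ (∑ i, d i ^ 2) := by
      rw [← Finset.prod_pow_eq_pow_sum]
      refine Finset.prod_congr rfl fun i _ => ?_
      rw [Finset.prod_const, Finset.card_univ, Fintype.card_fin, ← pow_mul, sq]
    dsimp only
    rw [h1, mul_assoc]
  have hsum : ∑ r : Σ i : Fin k, Fin (d i), (p r.1 r.2).natDegree +
      ∑ c : Σ i : Fin k, Fin (d i), (d c.1 - c.2) =
      ∑ i, ((∑ j, (p i j).natDegree) + ∑ m : Fin (d i), (d i - m)) := by
    rw [Fintype.sum_sigma, Fintype.sum_sigma, Finset.sum_add_distrib]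
  have hlead : A.det.coeff (∑ r : Σ i : Fin k, Fin (d i), (p r.1 r.2).natDegree +
      ∑ c : Σ i : Fin k, Fin (d i), (d c.1 - c.2)) ≠ 0 := by
    rw [coeff_det_sum A (fun r => (p r.1 r.2).natDegree) (fun c => d c.1 - c.2) hA]
    -- Entries off the diagonal blocks fall short of the weight bound. In each block the falling
    -- factorials are monic polynomials of degree `m` in the degree of `p i j`, so the determinant
    -- reduces to a Vandermonde determinant in distinct degrees.
    have h1 : (Matrix.of fun r c : Σ i : Fin k, Fin (d i) =>
        (A r c).coeff ((p r.1 r.2).natDegree + (d c.1 - c.2))) =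
        Matrix.blockDiagonal' fun i => Matrix.of fun j m : Fin (d i) =>
          (p i j).leadingCoeff * ((p i j).natDegree.descFactorial m : ℂ) := by
      ext1 ⟨i, j⟩ ⟨i', m⟩
      refine (coeff_reducedMatrix hdet p _ _ _ le_rfl).trans ?_
      dsimp only
      by_cases hi : i = i'
      · subst hi
        rw [if_pos ⟨rfl, rfl⟩, Matrix.blockDiagonal'_apply_eq, Matrix.of_apply, mul_comm]
      · rw [if_neg fun h => hi h.1, Matrix.blockDiagonal'_apply_ne _ _ _ hi]
    rw [h1]
    refine det_blockDiagonal'_ne_zero _ fun i => ?_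
    have h2 := Matrix.det_mul_column (fun j => (p i j).leadingCoeff)
      (Matrix.of fun j m : Fin (d i) => ((p i j).natDegree.descFactorial m : ℂ))
    have h3 := Matrix.det_eval_matrixOfPolynomials_eq_det_vandermonde
      (fun j : Fin (d i) => ((p i j).natDegree : ℂ)) (fun m => descPochhammer ℂ m)
      (fun m => descPochhammer_natDegree ℂ m) (fun m => monic_descPochhammer ℂ m)
    simp only [descPochhammer_eval_eq_descFactorial] at h3
    simp only [Matrix.of_apply] at h2
    rw [h2, ← h3]
    refine mul_ne_zero (Finset.prod_ne_zero_iff.2 fun j _ => leadingCoeff_ne_zero.2 (hp0 i j))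
      (Matrix.det_vandermonde_ne_zero_iff.2 fun j j' h => hp i (Nat.cast_injective h))
  have hA0 : A.det ≠ 0 := fun h => hlead (by rw [h, Polynomial.coeff_zero])
  have hw0 : wronskiPoly d Q p ≠ 0 := by
    intro h
    rw [h, mul_zero] at hAdet
    exact mul_ne_zero hA0 (Polynomial.C_ne_zero.2 hdet) hAdet
  refine ⟨hw0, ?_⟩
  have h1 := congrArg natDegree hAdet
  rw [natDegree_mul_C hdet, natDegree_X_pow_mul _ hw0] at h1
  rw [← h1, ← hsum]
  exact natDegree_det_le_sum A (fun r => (p r.1 r.2).natDegree) (fun c => d c.1 - c.2) hA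

/-- Distinct numbers below `l` have sum at most `(l - 1) + ⋯ + (l - n)`, and the second sum is `1 +
⋯ + n`; the pairs add up to `l` each. -/
theorem sum_add_sum_le_mul {n l : ℕ} (e : Fin n → ℕ) (he : Function.Injective e)
    (hl : ∀ j, e j < l) : (∑ j, e j) + ∑ m : Fin n, (n - m) ≤ l * n := by
  have h1 := Finset.sum_le_sum_range (s := Finset.univ.image fun j => (e j : ℤ)) (c := (l : ℤ) - 1)
    (by
      intro x hx
      obtain ⟨j, -, rfl⟩ := Finset.mem_image.1 hx
      have := hl j
      omega)
  rw [Finset.sum_image fun a _ b _ h => he (Nat.cast_injective h),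
    Finset.card_image_of_injective _ fun a b h => he (Nat.cast_injective h), Finset.card_univ,
    Fintype.card_fin, ← Fin.sum_univ_eq_sum_range (fun m => (l : ℤ) - 1 - m)] at h1
  have h2 : ((∑ m : Fin n, (n - m) : ℕ) : ℤ) = ∑ m : Fin n, ((n : ℤ) - (m : ℕ)) := by
    push_cast
    exact Finset.sum_congr rfl fun m _ => by rw [Nat.cast_sub m.2.le]
  have h3 : ∑ m : Fin n, ((l : ℤ) - 1 - (m : ℕ)) + ∑ m : Fin n, ((n : ℤ) - (m : ℕ)) =
      (l : ℤ) * n := by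
    have h4 : ∑ m : Fin n, ((n : ℤ) - (m : ℕ)) = ∑ m : Fin n, ((m : ℕ) + 1 : ℤ) := by
      rw [← Equiv.sum_comp Fin.revPerm]
      refine Finset.sum_congr rfl fun m _ => ?_
      rw [Fin.revPerm_apply, Fin.val_rev]
      have := m.2
      omega
    rw [h4, ← Finset.sum_add_distrib]
    have h5 : ∀ m : Fin n, (l : ℤ) - 1 - (m : ℕ) + ((m : ℕ) + 1) = l := fun m => by ring
    simp only [h5, Finset.sum_const, Finset.card_univ, Fintype.card_fin, nsmul_eq_mul]
    ring
  zify
  push_cast at h2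
  rw [h2, ← h3]
  linarith

/-- A space of polynomials has a basis consisting of polynomials of distinct degrees. -/
theorem exists_basis_injective_natDegree {n l : ℕ} (V : Gr n l) :
    ∃ b : Module.Basis (Fin n) ℂ V.1, Function.Injective fun j => (b j : ℂ[X]).natDegree := by
  obtain ⟨V, hV, hn⟩ := V
  dsimp only
  let D : Set ℕ := {e | ∃ p ∈ V, p ≠ 0 ∧ p.natDegree = e}
  have hDl : D ⊆ Set.Iio l := by
    rintro e ⟨p, hp, hp0, rfl⟩
    exact (natDegree_lt_iff_degree_lt hp0).2 (mem_degreeLT.1 (hV hp))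
  have hDfin : D.Finite := (Set.finite_Iio l).subset hDl
  have := hDfin.fintype
  have hfd : FiniteDimensional ℂ V := by
    have : FiniteDimensional ℂ (degreeLT ℂ l) :=
      (degreeLTEquiv ℂ l).symm.finiteDimensional
    exact Submodule.finiteDimensional_of_le hV
  have hcard : n ≤ Fintype.card D := by
    -- An element of `V` whose coefficients vanish at all degrees occurring in `V` has zero leading
    -- coefficient, so at least `n` degrees occur.
    let φ : V →ₗ[ℂ] (D → ℂ) := LinearMap.pi fun e => (lcoeff ℂ e).comp V.subtype
    have hφ : Function.Injective φ := by
      rw [injective_iff_map_eq_zero]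
      rintro ⟨p, hp⟩ h
      by_contra hp0
      have hp0' : p ≠ 0 := fun h => hp0 (Subtype.ext h)
      exact hp0' (leadingCoeff_eq_zero.1 (congrFun h ⟨p.natDegree, p, hp, hp0', rfl⟩))
    have h := LinearMap.finrank_le_finrank_of_injective hφ
    rwa [hn, Module.finrank_fintype_fun_eq_card] at h
  choose q hqV hq0 hqd using fun e : D => e.2
  let ε : Fin n ↪ D := (Fin.castLEEmb hcard).trans (Fintype.equivFin D).symm.toEmbedding
  have hinj : Function.Injective fun j => (q (ε j)).natDegree := by
    intro j j' h
    dsimp only at h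
    rw [hqd, hqd] at h
    exact ε.injective (Subtype.ext h)
  have hli : LinearIndependent ℂ fun j => q (ε j) := by
    rw [Fintype.linearIndependent_iff]
    intro g hg i
    by_contra hgi
    have hpair : {i | i ∈ Finset.univ ∧ g i • q (ε i) ≠ 0}.Pairwise
        (Function.onFun Ne fun i => (g i • q (ε i)).degree) := by
      intro x hx y hy hxy h
      refine hxy (hinj ?_)
      have hx' := (smul_ne_zero_iff.1 hx.2).1
      have hy' := (smul_ne_zero_iff.1 hy.2).1
      dsimp only [Function.onFun] at h
      rw [Polynomial.smul_eq_C_mul, Polynomial.smul_eq_C_mul, degree_C_mul hx',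
        degree_C_mul hy'] at h
      exact natDegree_eq_of_degree_eq h
    have h1 := degree_sum_eq_of_disjoint _ Finset.univ hpair
    rw [hg, degree_zero] at h1
    have h2 := Finset.le_sup (f := fun i => (g i • q (ε i)).degree) (Finset.mem_univ i)
    rw [← h1, le_bot_iff, degree_eq_bot] at h2
    exact smul_ne_zero hgi (hq0 _) h2
  have hli' : LinearIndependent ℂ fun j => (⟨q (ε j), hqV _⟩ : V) :=
    LinearIndependent.of_comp V.subtype hli
  let b := basisOfLinearIndependentOfCardEqFinrank' _ hli' (by rw [Fintype.card_fin, hn])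
  refine ⟨b, ?_⟩
  have hb : ∀ j, (b j : ℂ[X]) = q (ε j) := fun j => by
    simp [b]
  simpa only [hb] using hinj

end WronskiPoly

/-! ### Independence of bases, nonvanishing and the degree bound -/

section Bases

open Polynomial

variable {k l : ℕ} {d : Fin k → ℕ} {Q : Fin k → ℂ}

theorem exists_wronskiPoly_eq_C_mul (V : (i : Fin k) → Gr (d i) l)
    (b b' : (i : Fin k) → Module.Basis (Fin (d i)) ℂ (V i).1) :
    ∃ c : ℂ, c ≠ 0 ∧ wronskiPoly d Q (fun i j => (b i j : ℂ[X])) =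
      Polynomial.C c * wronskiPoly d Q fun i j => (b' i j : ℂ[X]) := by
  let T : ∀ i, Matrix (Fin (d i)) (Fin (d i)) ℂ := fun i => ((b' i).toMatrix (b i)).transpose
  refine ⟨_, det_blockDiagonal'_ne_zero T fun i => ?_,
    wronskiPoly_change_basis d Q T _ _ fun i j => ?_⟩
  · rw [Matrix.det_transpose]
    have h := (b' i).toMatrix_mul_toMatrix_flip (b i)
    intro h0
    have h1 := congrArg Matrix.det h
    rw [Matrix.det_mul, h0, zero_mul, Matrix.det_one] at h1
    exact zero_ne_one h1
  · have h := congrArg Subtype.val ((b' i).sum_toMatrix_smul_self (b i) j)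
    refine h.symm.trans ?_
    rw [Submodule.coe_sum]
    rfl

/-- Both claims are unchanged by a nonzero constant, so bases with distinct degrees suffice; the
bound is `sum_add_sum_le_mul` summed over the blocks. -/
theorem wronskiPoly_ne_zero_and_mem_degreeLT (hQ : Function.Injective Q)
    (h0 : ∀ i, Q i ≠ 0) (V : (i : Fin k) → Gr (d i) l)
    (b : (i : Fin k) → Module.Basis (Fin (d i)) ℂ (V i).1) :
    wronskiPoly d Q (fun i j => (b i j : ℂ[X])) ≠ 0 ∧
      wronskiPoly d Q (fun i j => (b i j : ℂ[X])) ∈ degreeLT ℂ (wronskiDim d l) := by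
  choose b' hb' using fun i => exists_basis_injective_natDegree (V i)
  obtain ⟨c, hc, hbc⟩ := exists_wronskiPoly_eq_C_mul (Q := Q) V b b'
  have hb0 : ∀ i j, (b' i j : ℂ[X]) ≠ 0 := fun i j h => (b' i).ne_zero j (Subtype.ext h)
  obtain ⟨h1, h2⟩ := wronskiPoly_of_injective_natDegree hQ h0 (fun i j => (b' i j : ℂ[X])) hb0 hb'
  have h3 : ∑ i, ((∑ j, (b' i j : ℂ[X]).natDegree) + ∑ m : Fin (d i), (d i - m)) ≤
      l * ∑ i, d i := by
    rw [Finset.mul_sum]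
    refine Finset.sum_le_sum fun i _ => sum_add_sum_le_mul _ (hb' i) fun j => ?_
    exact (natDegree_lt_iff_degree_lt (hb0 i j)).2 (mem_degreeLT.1 ((V i).2.1 (b' i j).2))
  have h4 : wronskiPoly d Q (fun i j => (b i j : ℂ[X])) ≠ 0 := by
    rw [hbc]
    exact mul_ne_zero (Polynomial.C_ne_zero.2 hc) h1
  refine ⟨h4, mem_degreeLT.2 ((natDegree_lt_iff_degree_lt h4).1 ?_)⟩
  rw [hbc, natDegree_C_mul hc, wronskiDim]
  omega

end Bases

/-! ### The Wronskian in terms of the Segre–Plücker coordinates -/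

/-- Sorting the columns costs a sign, and a repeated column gives zero. The pair is chosen before
`M`, so minors with arbitrary columns become fixed linear forms in the Plücker coordinates; `hn`
only provides a default column set when the factor is zero. -/
theorem exists_det_submatrix_eq {n l : ℕ} (hn : n ≤ l) (f : Fin n → Fin l) :
    ∃ x : ℂ × (Fin n ↪o Fin l), ∀ M : Matrix (Fin n) (Fin l) ℂ,
      (M.submatrix id f).det = x.1 * (M.submatrix id x.2).det := by
  by_cases hf : Function.Injective f
  · have hmono : StrictMono (f ∘ Tuple.sort f) :=
      (Tuple.monotone_sort f).strictMono_of_injective (hf.comp (Tuple.sort f).injective)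
    refine ⟨((Equiv.Perm.sign (Tuple.sort f)⁻¹ : ℤ), OrderEmbedding.ofStrictMono _ hmono),
      fun M => ?_⟩
    rw [← Matrix.det_permute', Matrix.submatrix_submatrix]
    congr 2
    funext j
    simp
  · refine ⟨(0, Fin.castLEOrderEmb hn), fun M => ?_⟩
    rw [zero_mul]
    obtain ⟨i, j, hij, hne⟩ := Function.not_injective_iff.1 hf
    exact Matrix.det_zero_of_column_eq hne fun r => by simp [hij]

/-- The sign that relates the minor with columns `f` to a minor with increasing columns. -/
def sortSign {n l : ℕ} (hn : n ≤ l) (f : Fin n → Fin l) : ℂ :=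
  (exists_det_submatrix_eq hn f).choose.1

/-- The increasing sequence of columns of a minor with columns `f`. -/
def sortCols {n l : ℕ} (hn : n ≤ l) (f : Fin n → Fin l) : Fin n ↪o Fin l :=
  (exists_det_submatrix_eq hn f).choose.2

theorem det_submatrix_eq {n l : ℕ} (hn : n ≤ l) (f : Fin n → Fin l)
    (M : Matrix (Fin n) (Fin l) ℂ) :
    (M.submatrix id f).det = sortSign hn f * (M.submatrix id (sortCols hn f)).det :=
  (exists_det_submatrix_eq hn f).choose_spec M

/-- Both sides are homomorphisms from the product of the permutation groups, so they are compared on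
transpositions in a single factor. -/
theorem sign_sigmaCongrRight {ι : Type*} [Fintype ι] [DecidableEq ι] {α : ι → Type*}
    [∀ i, Fintype (α i)] [∀ i, DecidableEq (α i)] (τ : ∀ i, Equiv.Perm (α i)) :
    Equiv.Perm.sign (Equiv.Perm.sigmaCongrRight τ) = ∏ i, Equiv.Perm.sign (τ i) := by
  let φ : (∀ i, Equiv.Perm (α i)) →* ℤˣ :=
    Equiv.Perm.sign.comp (Equiv.Perm.sigmaCongrRightHom α)
  let ψ : (∀ i, Equiv.Perm (α i)) →* ℤˣ :=
    ∏ i, Equiv.Perm.sign.comp (Pi.evalMonoidHom (fun i => Equiv.Perm (α i)) i)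
  have hψ : ∀ τ, ψ τ = ∏ i, Equiv.Perm.sign (τ i) := fun τ => by
    simp [ψ, MonoidHom.finsetProd_apply]
  have h : φ = ψ := by
    refine MonoidHom.pi_ext fun i x => ?_
    induction x using Equiv.Perm.swap_induction_on with
    | one => simp
    | swap_mul f x y hxy ih =>
      rw [Pi.mulSingle_mul, map_mul, map_mul, ih]
      congr 1
      rw [hψ, Finset.prod_eq_single i]
      · rw [Pi.mulSingle_eq_same, Equiv.Perm.sign_swap hxy]
        have h1 : Equiv.Perm.sigmaCongrRight (Pi.mulSingle i (Equiv.swap x y)) =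
            Equiv.swap (⟨i, x⟩ : Σ i, α i) ⟨i, y⟩ := by
          ext1 ⟨j, z⟩
          by_cases hj : j = i
          · subst hj
            simp only [Equiv.Perm.sigmaCongrRight, Equiv.sigmaCongrRight_apply,
              Pi.mulSingle_eq_same, Equiv.swap_apply_def, Sigma.mk.injEq, heq_eq_eq, true_and]
            split_ifs <;> rfl
          · rw [Equiv.swap_apply_of_ne_of_ne]
            · simp [Equiv.Perm.sigmaCongrRight, Pi.mulSingle_eq_of_ne hj]
            · intro h
              exact hj (congrArg Sigma.fst h)
            · intro h
              exact hj (congrArg Sigma.fst h)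
        change Equiv.Perm.sign (Equiv.Perm.sigmaCongrRight _) = -1
        rw [h1, Equiv.Perm.sign_swap]
        intro h
        rw [Sigma.mk.injEq] at h
        exact hxy (eq_of_heq h.2)
      · intro j _ hj
        rw [Pi.mulSingle_eq_of_ne hj, map_one]
      · simp
  rw [← hψ, ← h]
  rfl

section Expansion

open Polynomial

variable {k l : ℕ} (d : Fin k → ℕ) (Q : Fin k → ℂ)

/-- The Wronskian of monomials. -/
def monomialWronskian (F : (Σ i : Fin k, Fin (d i)) → Fin l) : ℂ[X] :=
  wronskiPoly d Q fun i j => Polynomial.X ^ (F ⟨i, j⟩ : ℕ)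

theorem monomialWronskian_comp_perm (F : (Σ i : Fin k, Fin (d i)) → Fin l)
    (τ : ∀ i, Equiv.Perm (Fin (d i))) :
    monomialWronskian d Q (F ∘ Equiv.Perm.sigmaCongrRight τ) =
      Polynomial.C (∏ i, ((Equiv.Perm.sign (τ i) : ℤ) : ℂ)) * monomialWronskian d Q F := by
  have h := Matrix.det_permute (Equiv.Perm.sigmaCongrRight τ)
    (wronskiMatrix d Q fun i j => Polynomial.X ^ (F ⟨i, j⟩ : ℕ))
  rw [monomialWronskian, monomialWronskian, wronskiPoly, wronskiPoly]
  refine Eq.trans ?_ (h.trans ?_)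
  · rfl
  · rw [sign_sigmaCongrRight]
    congr 1
    simp

/-- The determinant is multilinear in the rows, and each row is linear in the coefficients of its
polynomial. -/
theorem wronskiPoly_eq_sum (p : (i : Fin k) → Fin (d i) → ℂ[X])
    (hp : ∀ i j, p i j ∈ degreeLT ℂ l) :
    wronskiPoly d Q p = ∑ F : (Σ i : Fin k, Fin (d i)) → Fin l,
      Polynomial.C (∏ r : Σ i : Fin k, Fin (d i), (p r.1 r.2).coeff (F r)) *
        monomialWronskian d Q F := by
  let R : (r : Σ i : Fin k, Fin (d i)) → Fin l → (Σ i : Fin k, Fin (d i)) → ℂ[X] :=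
    fun r a c => Polynomial.C (Q r.1 ^ (finSigmaFinEquiv c : ℕ)) *
      taylor ((finSigmaFinEquiv c : ℕ) : ℂ) (Polynomial.X ^ (a : ℕ))
  have h1 : wronskiMatrix d Q p =
      fun r => ∑ a, Polynomial.C ((p r.1 r.2).coeff (a : Fin l)) • R r a := by
    funext r c
    have h2 : p r.1 r.2 = ∑ a : Fin l, (p r.1 r.2).coeff a • Polynomial.X ^ (a : ℕ) := by
      by_cases h0 : p r.1 r.2 = 0
      · simp [h0]
      · have h3 := (natDegree_lt_iff_degree_lt h0).2 (mem_degreeLT.1 (hp r.1 r.2))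
        conv_lhs => rw [as_sum_range' _ l h3]
        rw [← Fin.sum_univ_eq_sum_range
          (fun a => Polynomial.monomial a ((p r.1 r.2).coeff a))]
        refine Finset.sum_congr rfl fun a _ => ?_
        rw [Polynomial.smul_eq_C_mul, Polynomial.C_mul_X_pow_eq_monomial]
    rw [Finset.sum_apply, wronskiMatrix, Matrix.of_apply]
    conv_lhs => rw [h2]
    rw [map_sum, Finset.mul_sum]
    refine Finset.sum_congr rfl fun a _ => ?_
    rw [map_smul, Polynomial.smul_eq_C_mul, Pi.smul_apply, smul_eq_mul]
    ring
  have h3 : wronskiPoly d Q p = Matrix.detRowAlternating.toMultilinearMap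
      fun r => ∑ a, Polynomial.C ((p r.1 r.2).coeff (a : Fin l)) • R r a := by
    rw [wronskiPoly, h1]
    rfl
  rw [h3, MultilinearMap.map_sum]
  refine Finset.sum_congr rfl fun F _ => ?_
  rw [MultilinearMap.map_smul_univ, map_prod]
  rfl

/-- The averaged expansion of the Wronskian in terms of products of maximal minors. -/
theorem prod_factorial_mul_wronskiPoly (p : (i : Fin k) → Fin (d i) → ℂ[X])
    (hp : ∀ i j, p i j ∈ degreeLT ℂ l) :
    Polynomial.C (∏ i, ((d i).factorial : ℂ)) * wronskiPoly d Q p =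
      ∑ F : (Σ i : Fin k, Fin (d i)) → Fin l,
        Polynomial.C (∏ i, (Matrix.of fun r c : Fin (d i) => (p i r).coeff (F ⟨i, c⟩)).det) *
          monomialWronskian d Q F := by
  -- Reindexing `F` by `τ` moves the permutation onto the coefficients at the cost of its sign.
  -- Summing over all `τ` then assembles the minors and produces the factorials on the left.
  have h1 : ∀ τ : ∀ i, Equiv.Perm (Fin (d i)), wronskiPoly d Q p =
      ∑ F : (Σ i : Fin k, Fin (d i)) → Fin l,
        Polynomial.C (∏ i, ((Equiv.Perm.sign (τ i) : ℤ) : ℂ) *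
          ∏ j, (p i j).coeff (F ⟨i, τ i j⟩)) * monomialWronskian d Q F := by
    intro τ
    rw [wronskiPoly_eq_sum d Q p hp,
      ← Equiv.sum_comp (Equiv.arrowCongr (Equiv.Perm.sigmaCongrRight τ)⁻¹ (Equiv.refl (Fin l)))]
    refine Finset.sum_congr rfl fun F _ => ?_
    have h2 : Equiv.arrowCongr (Equiv.Perm.sigmaCongrRight τ)⁻¹ (Equiv.refl (Fin l)) F =
        F ∘ Equiv.Perm.sigmaCongrRight τ := by
      funext r
      rfl
    have h5 : ∏ r : Σ i : Fin k, Fin (d i),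
        (p r.1 r.2).coeff ((F ∘ Equiv.Perm.sigmaCongrRight τ) r : ℕ) =
          ∏ i, ∏ j, (p i j).coeff (F ⟨i, τ i j⟩ : ℕ) := by
      rw [Fintype.prod_sigma]
      rfl
    rw [h2, monomialWronskian_comp_perm, h5, Finset.prod_mul_distrib, ← mul_assoc,
      ← Polynomial.C_mul, mul_comm (∏ i, ∏ j, (p i j).coeff (F ⟨i, τ i j⟩ : ℕ))]
  have h3 : ∑ _τ : ∀ i, Equiv.Perm (Fin (d i)), wronskiPoly d Q p =
      Polynomial.C (∏ i, ((d i).factorial : ℂ)) * wronskiPoly d Q p := by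
    rw [Finset.sum_const, Finset.card_univ, Fintype.card_pi, nsmul_eq_mul]
    simp [Fintype.card_perm]
  rw [← h3, Finset.sum_congr rfl fun τ _ => h1 τ, Finset.sum_comm]
  refine Finset.sum_congr rfl fun F _ => ?_
  rw [← Finset.sum_mul, ← map_sum]
  congr 2
  have h4 : ∀ i, (Matrix.of fun r c : Fin (d i) => (p i r).coeff (F ⟨i, c⟩)).det =
      ∑ σ : Equiv.Perm (Fin (d i)), ((Equiv.Perm.sign σ : ℤ) : ℂ) *
        ∏ j, (p i j).coeff (F ⟨i, σ j⟩) := by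
    intro i
    rw [← Matrix.det_transpose, Matrix.det_apply']
    rfl
  simp only [h4]
  rw [Finset.prod_univ_sum, Fintype.piFinset_univ]

/-- The linear form in the Segre–Plücker coordinates that computes a coefficient of the
Wronskian. -/
def wronskiForm (hd : ∀ i, d i ≤ l) (s : ℕ) :
    MvPolynomial ((i : Fin k) → Fin (d i) ↪o Fin l) ℂ :=
  ∑ F : (Σ i : Fin k, Fin (d i)) → Fin l,
    MvPolynomial.C ((∏ i, ((d i).factorial : ℂ))⁻¹ * (monomialWronskian d Q F).coeff s *
      ∏ i, sortSign (hd i) fun j => F ⟨i, j⟩) *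
      MvPolynomial.X fun i => sortCols (hd i) fun j => F ⟨i, j⟩

theorem isHomogeneous_wronskiForm (hd : ∀ i, d i ≤ l) (s : ℕ) :
    (wronskiForm d Q hd s).IsHomogeneous 1 :=
  IsHomogeneous.sum _ _ _ fun _ _ => isHomogeneous_C_mul_X _ _

theorem eval_wronskiForm (hd : ∀ i, d i ≤ l) (s : ℕ) (p : (i : Fin k) → Fin (d i) → ℂ[X])
    (hp : ∀ i j, p i j ∈ degreeLT ℂ l) :
    MvPolynomial.eval (segrePlucker d l p) (wronskiForm d Q hd s) =
      (wronskiPoly d Q p).coeff s := by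
  have hfac : (∏ i, ((d i).factorial : ℂ)) ≠ 0 :=
    Finset.prod_ne_zero_iff.2 fun i _ => Nat.cast_ne_zero.2 (Nat.factorial_ne_zero _)
  have h1 := congrArg (fun P => Polynomial.coeff P s) (prod_factorial_mul_wronskiPoly d Q p hp)
  simp only [Polynomial.coeff_C_mul, finsetSum_coeff] at h1
  rw [← mul_right_inj' hfac, h1, wronskiForm, map_sum, Finset.mul_sum]
  refine Finset.sum_congr rfl fun F _ => ?_
  have h2 : ∀ i, (Matrix.of fun r c : Fin (d i) => (p i r).coeff (F ⟨i, c⟩)).det =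
      sortSign (hd i) (fun j => F ⟨i, j⟩) * (Matrix.of fun r c : Fin (d i) =>
        (p i r).coeff (sortCols (hd i) (fun j => F ⟨i, j⟩) c : ℕ)).det := fun i =>
    det_submatrix_eq (hd i) (fun j => F ⟨i, j⟩) (Matrix.of fun r c => (p i r).coeff (c : ℕ))
  simp only [h2, Finset.prod_mul_distrib]
  rw [map_mul, MvPolynomial.eval_C, MvPolynomial.eval_X, segrePlucker, mul_assoc, mul_assoc,
    mul_inv_cancel_left₀ hfac]
  ring

end Expansion

/-! ### The product of Grassmannians is closed -/

theorem isHomogeneous_det {σ R : Type*} [CommRing R] {n : ℕ}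
    (A : Matrix (Fin n) (Fin n) (MvPolynomial σ R)) (hA : ∀ r c, (A r c).IsHomogeneous 1) :
    A.det.IsHomogeneous n := by
  rw [Matrix.det_apply]
  refine IsHomogeneous.sum _ _ _ fun τ _ => ?_
  have h := IsHomogeneous.prod Finset.univ (fun i => A (τ i) i) (fun _ => 1) fun i _ => hA _ _
  rw [Finset.sum_const, Finset.card_univ, Fintype.card_fin, smul_eq_mul, mul_one] at h
  rw [← mem_homogeneousSubmodule] at h ⊢
  rw [Units.smul_def]
  exact zsmul_mem h _

section Closed

variable {k l : ℕ} {d : Fin k → ℕ}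

/-- A Segre–Plücker coordinate obtained from the coordinate `J₀` by exchanging, up to a sign, the
`r`-th column of the `i`-th minor for the column `c`. -/
def exchangeForm (hd : ∀ i, d i ≤ l) (J₀ : (i : Fin k) → Fin (d i) ↪o Fin l) (i : Fin k)
    (r : Fin (d i)) (c : Fin l) : MvPolynomial ((i : Fin k) → Fin (d i) ↪o Fin l) ℂ :=
  C (sortSign (hd i) (Function.update (J₀ i) r c)) *
    X (Function.update J₀ i (sortCols (hd i) (Function.update (J₀ i) r c)))

/-- The matrix of coefficients of polynomials. -/
def coeffMatrix (l : ℕ) {n : ℕ} (p : Fin n → Polynomial ℂ) : Matrix (Fin n) (Fin l) ℂ :=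
  Matrix.of fun r c => (p r).coeff (c : ℕ)

/-- Cramer's rule: replacing a column of an invertible minor by column `c` computes an entry of the
adjugate times the coefficient matrix. As `c` varies, the exchange coordinates give that matrix up
to the minors of the other blocks. -/
theorem eval_exchangeForm (hd : ∀ i, d i ≤ l) (J₀ : (i : Fin k) → Fin (d i) ↪o Fin l) (i : Fin k)
    (p : (i : Fin k) → Fin (d i) → Polynomial ℂ) (r : Fin (d i)) (c : Fin l) :
    eval (segrePlucker d l p) (exchangeForm hd J₀ i r c) =
      (∏ i' ∈ Finset.univ.erase i, ((coeffMatrix l (p i')).submatrix id (J₀ i')).det) *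
        (((coeffMatrix l (p i)).submatrix id (J₀ i)).adjugate * coeffMatrix l (p i)) r c := by
  have h1 : (((coeffMatrix l (p i)).submatrix id (J₀ i)).adjugate * coeffMatrix l (p i)) r c =
      ((coeffMatrix l (p i)).submatrix id (Function.update (J₀ i) r c)).det := by
    have h2 : (((coeffMatrix l (p i)).submatrix id (J₀ i)).adjugate * coeffMatrix l (p i)) r c =
        Matrix.mulVec ((coeffMatrix l (p i)).submatrix id (J₀ i)).adjugate
          (fun s => coeffMatrix l (p i) s c) r := rfl
    rw [h2, ← Matrix.cramer_eq_adjugate_mulVec, Matrix.cramer_apply]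
    congr 1
    ext s t
    rw [Matrix.updateCol_apply, Matrix.submatrix_apply, Matrix.submatrix_apply,
      Function.update_apply]
    split_ifs <;> rfl
  have h3 : segrePlucker d l p
        (Function.update J₀ i (sortCols (hd i) (Function.update (J₀ i) r c))) =
      (∏ i' ∈ Finset.univ.erase i, ((coeffMatrix l (p i')).submatrix id (J₀ i')).det) *
        ((coeffMatrix l (p i)).submatrix id
          (sortCols (hd i) (Function.update (J₀ i) r c))).det := by
    rw [segrePlucker, ← Finset.prod_erase_mul _ _ (Finset.mem_univ i), Function.update_self]
    congr 1
    refine Finset.prod_congr rfl fun i' hi' => ?_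
    rw [Function.update_of_ne (Finset.ne_of_mem_erase hi')]
    rfl
  rw [h1, det_submatrix_eq (hd i), exchangeForm, map_mul, eval_C, eval_X, h3]
  ring

theorem det_adjugate_mul (n : ℕ) (A : Matrix (Fin n) (Fin n) ℂ) :
    A.det * A.adjugate.det = A.det ^ n := by
  rw [← Matrix.det_mul, Matrix.mul_adjugate, Matrix.det_smul, Matrix.det_one, mul_one,
    Fintype.card_fin]

/-- The relation that expresses the coordinate `J` through the coordinates close to `J₀`. -/
def exchangeRelation (hd : ∀ i, d i ≤ l) (J₀ J : (i : Fin k) → Fin (d i) ↪o Fin l) :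
    MvPolynomial ((i : Fin k) → Fin (d i) ↪o Fin l) ℂ :=
  X J₀ * (∏ i, (Matrix.of fun r c => exchangeForm hd J₀ i r (J i c)).det) -
    X J * X J₀ ^ ∑ i, d i

theorem isHomogeneous_exchangeRelation (hd : ∀ i, d i ≤ l)
    (J₀ J : (i : Fin k) → Fin (d i) ↪o Fin l) :
    (exchangeRelation hd J₀ J).IsHomogeneous (1 + ∑ i, d i) := by
  refine IsHomogeneous.sub ((isHomogeneous_X _ _).mul (IsHomogeneous.prod _ _ _ fun i _ =>
    isHomogeneous_det _ fun r c => isHomogeneous_C_mul_X _ _)) ?_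
  have h := (isHomogeneous_X ℂ J).mul ((isHomogeneous_X ℂ J₀).pow (∑ i, d i))
  rwa [one_mul] at h

/-- With `D i` the minors at `J₀`, the `i`-th determinant is `(∏_{i' ≠ i} D i')^(d i) * det (adj)`
times the minor at `J i`. The factor `X J₀` supplies one `D i` per block, and `D i * det (adj) = D i
^ d i` completes the power of `∏ D i`. -/
theorem eval_exchangeRelation (hd : ∀ i, d i ≤ l) (J₀ J : (i : Fin k) → Fin (d i) ↪o Fin l)
    (p : (i : Fin k) → Fin (d i) → Polynomial ℂ) :
    eval (segrePlucker d l p) (exchangeRelation hd J₀ J) = 0 := by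
  let D : Fin k → ℂ := fun i => ((coeffMatrix l (p i)).submatrix id (J₀ i)).det
  have hJ : ∀ J : (i : Fin k) → Fin (d i) ↪o Fin l,
      segrePlucker d l p J = ∏ i, ((coeffMatrix l (p i)).submatrix id (J i)).det := fun _ => rfl
  have h1 : ∀ i, D i * eval (segrePlucker d l p)
      (Matrix.of fun r c => exchangeForm hd J₀ i r (J i c)).det =
      (∏ i, D i) ^ d i * ((coeffMatrix l (p i)).submatrix id (J i)).det := by
    intro i
    have h2 : (eval (segrePlucker d l p)).mapMatrix
        (Matrix.of fun r c => exchangeForm hd J₀ i r (J i c)) =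
        (∏ i' ∈ Finset.univ.erase i, D i') •
          (((coeffMatrix l (p i)).submatrix id (J₀ i)).adjugate *
            (coeffMatrix l (p i)).submatrix id (J i)) := by
      ext r c
      exact eval_exchangeForm hd J₀ i p r (J i c)
    rw [RingHom.map_det, h2, Matrix.det_smul, Matrix.det_mul, Fintype.card_fin,
      ← Finset.prod_erase_mul _ _ (Finset.mem_univ i), mul_pow, ← det_adjugate_mul]
    ring
  rw [exchangeRelation, map_sub, map_mul, map_mul, map_pow, map_prod, eval_X, eval_X, hJ J₀, hJ J,
    ← Finset.prod_mul_distrib, Finset.prod_congr rfl fun i _ => h1 i, Finset.prod_mul_distrib,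
    Finset.prod_pow_eq_pow_sum]
  ring

theorem exchangeRelation_mem (hd : ∀ i, d i ≤ l) (J₀ J : (i : Fin k) → Fin (d i) ↪o Fin l) :
    exchangeRelation hd J₀ J ∈ (homogeneousVanishingIdeal (grCone d l)).toIdeal := by
  refine Ideal.subset_span ⟨⟨_, isHomogeneous_exchangeRelation hd J₀ J⟩, ?_⟩
  rintro v ⟨V, b, rfl⟩
  exact eval_exchangeRelation hd J₀ J _

theorem exists_gr_basis_of_det_ne_zero {m l : ℕ} (q : Fin m → Polynomial ℂ)
    (hq : ∀ j, q j ∈ Polynomial.degreeLT ℂ l) (J : Fin m ↪o Fin l)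
    (hJ : (Matrix.of fun r c : Fin m => (q r).coeff (J c : ℕ)).det ≠ 0) :
    ∃ (V : Gr m l) (b : Module.Basis (Fin m) ℂ V.1), ∀ j, (b j : Polynomial ℂ) = q j := by
  have hli : LinearIndependent ℂ q := by
    have h := Matrix.linearIndependent_rows_iff_isUnit.2
      ((Matrix.isUnit_iff_isUnit_det _).2 hJ.isUnit)
    refine LinearIndependent.of_comp (LinearMap.pi fun c : Fin m => Polynomial.lcoeff ℂ (J c)) ?_
    exact h
  refine ⟨⟨Submodule.span ℂ (Set.range q), Submodule.span_le.2 ?_, ?_⟩, Module.Basis.span hli,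
    fun j => congrArg Subtype.val (Module.Basis.span_apply hli j)⟩
  · rintro _ ⟨j, rfl⟩
    exact hq j
  · rw [finrank_span_eq_card hli, Fintype.card_fin]

/-- Every vector on which the homogeneous ideal of the product of Grassmannians vanishes is, up to
a nonzero factor, the vector of coordinates of a point of the product. -/
theorem exists_segrePlucker_eq_smul (hd : ∀ i, d i ≤ l)
    (v : ((i : Fin k) → Fin (d i) ↪o Fin l) → ℂ)
    (hv : ∀ P ∈ (homogeneousVanishingIdeal (grCone d l)).toIdeal, eval v P = 0) (h0 : v ≠ 0) :
    ∃ (V : (i : Fin k) → Gr (d i) l) (b : (i : Fin k) → Module.Basis (Fin (d i)) ℂ (V i).1)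
      (c : ℂ), segrePlucker d l (fun i j => (b i j : Polynomial ℂ)) = c • v := by
  obtain ⟨J₀, hJ₀⟩ := Function.ne_iff.1 h0
  -- For a genuine coordinate vector these polynomials would be, up to a scalar, the adjugate of the
  -- `i`-th minor applied to the basis, hence would lie in the same space. The exchange relations
  -- alone show that they have the coordinates of `v` up to a factor.
  let q : (i : Fin k) → Fin (d i) → Polynomial ℂ := fun i r =>
    ∑ c : Fin l, Polynomial.monomial c (eval v (exchangeForm hd J₀ i r c))
  have hq : ∀ i r (c : Fin l), (q i r).coeff c = eval v (exchangeForm hd J₀ i r c) := by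
    intro i r c
    simp [q, Polynomial.finsetSum_coeff, Polynomial.coeff_monomial, Fin.val_inj]
  have hdeg : ∀ i r, q i r ∈ Polynomial.degreeLT ℂ l := fun i r =>
    Submodule.sum_mem _ fun c _ => Polynomial.mem_degreeLT.2
      ((Polynomial.degree_monomial_le _ _).trans_lt (by exact_mod_cast c.2))
  have h1 : ∀ J, v J₀ * segrePlucker d l q J = v J₀ ^ (∑ i, d i) * v J := by
    intro J
    have h2 := hv _ (exchangeRelation_mem hd J₀ J)
    rw [exchangeRelation, map_sub, map_mul, map_mul, map_pow, map_prod, eval_X, eval_X,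
      sub_eq_zero] at h2
    rw [mul_comm _ (v J), ← h2, segrePlucker]
    congr 1
    refine Finset.prod_congr rfl fun i _ => ?_
    rw [RingHom.map_det]
    congr 1
    ext r c
    exact hq i r (J i c)
  have h3 : segrePlucker d l q J₀ ≠ 0 := fun h => by
    have h4 := h1 J₀
    rw [h, mul_zero] at h4
    exact mul_ne_zero (pow_ne_zero _ hJ₀) hJ₀ h4.symm
  choose V b hb using fun i => exists_gr_basis_of_det_ne_zero (q i) (hdeg i) (J₀ i)
    (Finset.prod_ne_zero_iff.1 h3 i (Finset.mem_univ i))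
  refine ⟨V, b, (v J₀)⁻¹ * v J₀ ^ (∑ i, d i), ?_⟩
  simp only [hb]
  funext J
  rw [Pi.smul_apply, smul_eq_mul, mul_assoc, ← h1, inv_mul_cancel_left₀ hJ₀]

end Closed

/-! ### The Wronski map as a projection from a disjoint center -/

section Main

variable {k l : ℕ} {d : Fin k → ℕ} {Q : Fin k → ℂ}

/-- This is the disjointness of the center: a nonzero such `v` would yield a tuple of spaces whose
Wronskian has all coefficients below `wronskiDim d l` equal to zero, hence is zero. -/
theorem eq_zero_of_eval_wronskiForm (hd : ∀ i, d i ≤ l) (hQ : Function.Injective Q)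
    (hQ0 : ∀ i, Q i ≠ 0) (v : ((i : Fin k) → Fin (d i) ↪o Fin l) → ℂ)
    (hv : ∀ P ∈ (homogeneousVanishingIdeal (grCone d l)).toIdeal, eval v P = 0)
    (h : ∀ s : Fin (wronskiDim d l), eval v (wronskiForm d Q hd s) = 0) : v = 0 := by
  by_contra h0
  obtain ⟨V, b, c, hc⟩ := exists_segrePlucker_eq_smul hd v hv h0
  obtain ⟨hne, hdeg⟩ := wronskiPoly_ne_zero_and_mem_degreeLT hQ hQ0 V b
  obtain ⟨s, hs⟩ := exists_coeff_ne_zero _ hdeg hne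
  apply hs
  rw [← eval_wronskiForm d Q hd s _ fun i j => (V i).2.1 (b i j).2, hc,
    eval_smul_of_isHomogeneous (isHomogeneous_wronskiForm d Q hd s), h, mul_zero]

/-- The line spanned by the Wronskian polynomial of bases of the spaces. -/
def wronskiLine (hQ : Function.Injective Q) (hQ0 : ∀ i, Q i ≠ 0) (V : (i : Fin k) → Gr (d i) l)
    (b : (i : Fin k) → Module.Basis (Fin (d i)) ℂ (V i).1) : Gr 1 (wronskiDim d l) :=
  ⟨Submodule.span ℂ {wronskiPoly d Q fun i j => (b i j : Polynomial ℂ)},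
    (Submodule.span_singleton_le_iff_mem _ _).2
      (wronskiPoly_ne_zero_and_mem_degreeLT hQ hQ0 V b).2,
    finrank_span_singleton (wronskiPoly_ne_zero_and_mem_degreeLT hQ hQ0 V b).1⟩

theorem wronskiLine_eq (hQ : Function.Injective Q) (hQ0 : ∀ i, Q i ≠ 0)
    (V : (i : Fin k) → Gr (d i) l)
    (b b' : (i : Fin k) → Module.Basis (Fin (d i)) ℂ (V i).1) :
    wronskiLine hQ hQ0 V b = wronskiLine hQ hQ0 V b' := by
  obtain ⟨c, hc, h⟩ := exists_wronskiPoly_eq_C_mul (Q := Q) V b b'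
  refine Subtype.ext ?_
  change Submodule.span ℂ _ = Submodule.span ℂ _
  rw [h, ← Polynomial.smul_eq_C_mul]
  exact Submodule.span_singleton_smul_eq hc.isUnit _

end Main

end DiscreteWronski

end

open DiscreteWronski AlgebraicGeometry CategoryTheory in
theorem mainTheorem10 (k l : ℕ) (d : Fin k → ℕ) (hd : ∀ i, 0 < d i)
    (hN : 2 ≤ ∑ i, d i) (hl : ∑ i, d i < l)
    (Q L : Fin k → ℂ) (hQ : Function.Injective Q) (hL : ∀ i, Complex.exp (L i) = Q i) :
    ∃ W : ((i : Fin k) → Gr (d i) l) → Gr 1 (wronskiDim d l),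
      IsDiscreteWronskiMap d l L W ∧
      ∃ φ : productGr d l ⟶ projectiveSpace (wronskiDim d l),
        φ ≫ structureMorphism (MvPolynomial.homogeneousSubmodule (Fin (wronskiDim d l)) ℂ) =
          structureMorphism (coordGrading (grCone d l)) ∧
        (∀ (V : (i : Fin k) → Gr (d i) l)
            (b : (i : Fin k) → Module.Basis (Fin (d i)) ℂ (V i).1)
            (w : Polynomial ℂ) (hw : w ∈ (W V).1) (h0 : w ≠ 0),
          φ (grPoint d l V b) = linePoint (wronskiDim d l) w ((W V).2.1 hw) h0) ∧
        IsFinite φ := by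
  have hQ0 : ∀ i, Q i ≠ 0 := fun i => hL i ▸ Complex.exp_ne_zero _
  have hdl : ∀ i, d i ≤ l := fun i =>
    (Finset.single_le_sum (fun j _ => Nat.zero_le (d j)) (Finset.mem_univ i)).trans hl.le
  -- Any bases would serve here: they only select a representative of the line, which
  -- `wronskiLine_eq` shows to be independent of them.
  choose B hB using fun (V : (i : Fin k) → Gr (d i) l) (i : Fin k) =>
    exists_basis_injective_natDegree (V i)
  obtain ⟨φ, hφ, hfin, hpt⟩ := exists_finite_linear_projection (grCone d l)
    (fun s : Fin (wronskiDim d l) => wronskiForm d Q hdl s)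
    (fun s => isHomogeneous_wronskiForm d Q hdl s)
    (fun v hv h => eq_zero_of_eval_wronskiForm hdl hQ hQ0 v hv h)
  refine ⟨fun V => wronskiLine hQ hQ0 V (B V), fun V b => ⟨wronskiPoly d Q fun i j => b i j,
    eval_wronskiPoly d Q L hL _, congrArg Subtype.val (wronskiLine_eq hQ hQ0 V (B V) b)⟩,
    φ, hφ, fun V b w hw h0 => ?_, hfin⟩
  have hw' : w ∈ (wronskiLine hQ hQ0 V b).1 := by
    rw [wronskiLine_eq hQ hQ0 V b (B V)]
    exact hw
  -- The given `w` is a multiple of the Wronskian of the given bases `b`, and this multiple is the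
  -- scalar relating the two coordinate vectors.
  obtain ⟨c, rfl⟩ := Submodule.mem_span_singleton.1 hw'
  refine hpt _ _ _ _ _ _ c fun s => ?_
  rw [eval_wronskiForm d Q hdl s _ fun i j => (V i).2.1 (b i j).2, Polynomial.coeff_smul,
    smul_eq_mul]
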